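/- Let $N\ge 2$, $q\in\mathbb R\setminus\{-1,0,1\}$, $Q=q-q^{-1}$, $s=\sum_{i=0}^{N-1}q^{2i}$, $s'=s-1$. Let $X=\mathrm S_q^{2N-1}$ be the unital $\mathbb C$-algebra with generators $z_i,z_i^*$ ($1\le i\le N$) and relations $z_iz_j=qz_jz_i$, $z_i^*z_j^*=q^{-1}z_j^*z_i^*$ ($i<j$), $z_iz_j^*=qz_j^*z_i$ ($i\ne j$), $z_iz_i^*-z_i^*z_i+q^{-1}Q\sum_{k>i}z_kz_k^*=0$, $\sum_i z_iz_i^*=1$. It is $\mathbb Z$-graded by $\deg z_i=1$, $\deg z_i^*=-1$. Let $R^{ij}_{kl}$ be $1$ if $i=l\ne k=j$, $q$ if $i=j=k=l$, $Q$ if $i=k<j=l$, and $0$ otherwise; let $(R^-)^{ij}_{kl}$ be $1$ if $i=l\neq k=j$, $q^{-1}$ if $i=j=k=l$, $-Q$ if $i=k>j=l$, and $0$ otherwise. Put $\check R^{ij}_{kl}=R^{lk}_{ji}$, $L^{ij}_{kl}=q^{2l-2i}(R^-)^{jl}_{ik}$, $P^{ij}_{kl}=R^{ki}_{lj}$. A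 first order differential calculus on $X$ is an $X$-bimodule $\Gamma$ with a $\mathbb C$-linear map $d:X\to\Gamma$ satisfying the Leibniz rule such that $\Gamma$ is spanned by the elements $x\,dy$. Put $H_+=\sum_i z_i\,dz_i^*$ and $H_-=\sum_i q^{-2i}z_i^*\,dz_i$. By an *invariant one-form* we mean a form $\mu H_++\lambda H_-$ with $\mu,\lambda\in\mathbb C$. We consider the calculi in which $dz_1,\dots,dz_N,dz_1^*,\dots,dz_N^*$ form a free left module basis of $\Gamma$ and whose bimodule structure is (summation over $s,t$ understood in $M^{st}_{kl}$) $$dz_k\,z_l=a_1(R^-)^{st}_{kl}z_s\,dz_t+b_1z_k\,dz_l+c_1z_kz_lH_++e_1z_kz_lH_-,$$ $$dz_k^*\,z_l^*=a_2\check R^{st}_{kl}z^*_s\,dz^*_t+b_2z^*_k\,dz^*_l+c_2z^*_kz^*_lH_++e_2z^*_kz^*_lH_-,$$ $$dz_k\,z_l^*=a_3L^{st}_{kl}z^*_s\,dz_t+b_3z_k\,dz^*_l+(c_3z_kz^*_l+d_3q^{2k}\delta_{kl})H_++(e_3z_kz^*_l+f_3q^{2k}\delta_{kl})H_-,$$ $$dz_k^*\,z_l=a_4P^{st}_{kl}z_s\,dz^*_t+b_4z^*_k\,dz_l+(c_4z^*_kz_l+d_4\delta_{kl})H_++(e_4z^*_kz_l+f_4\delta_{kl})H_-,$$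 with one of the following families of coefficients, where always $c_4=c_3$, $e_4=e_3$, $d_4=q^{2N}d_3$, $f_4=q^{2N}f_3$: - $\Gamma_{\alpha\tau}$ ($\alpha\in\mathbb R\setminus\{0,q^{-2}\}$, $\tau\in\mathbb R$): $a_1=a_4=q\alpha$, $a_2=a_3=q^{-1}\alpha^{-1}$, $b_1=b_3=q^2\alpha-1$, $b_2=b_4=q^{-2}\alpha^{-1}-1$, $c_1=q^2\alpha^2(1-s'\tau)$, $e_1=q^2(1-\alpha s'\tau)$, $c_2=1-s'\tau$, $e_2=\alpha^{-2}(1-\alpha s'\tau)$, $c_3=-q^2\alpha(1-s\tau)$, $d_3=-\alpha\tau$, $e_3=-\alpha^{-1}(1-q^2\alpha s\tau)$, $f_3=-\tau$. - $\Gamma'_{\alpha\omega}$ with real $\alpha$ ($\alpha\in\mathbb R\setminus\{0,q^{-2}\}$, $\omega\in\mathbb R\setminus\{0\}$): $a_i,b_i$ as for $\Gamma_{\alpha\tau}$, $c_1=\omega$, $e_1=\alpha^{-1}\omega-q^2(\alpha-1)$, $c_2=q^2\alpha\omega^{-1}-(\alpha^{-1}-1)$, $e_2=q^2\omega^{-1}$,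 $c_3=-q^2\alpha$, $e_3=-\alpha^{-1}$, $d_3=f_3=0$. - $\Gamma''_{\omega\psi}$ ($\omega\in\mathbb R\setminus\{0\}$, $\psi\in\mathbb R$): $a_1=a_4=q^{-1}$, $a_2=a_3=q$, all $b_i=0$, $c_1=\omega$, $e_1=q^2\omega\psi-1$, $c_2=\psi-q^2$, $e_2=q^2\omega^{-1}$, $c_3=-1$, $e_3=-q^2$, $d_3=f_3=0$. - $\Gamma'''_{\varrho\tau}$ ($\varrho,\tau\in\mathbb R\setminus\{0\}$): $a_i,b_i$ as for $\Gamma''_{\omega\psi}$, $c_1=-q^{-2}\frac{\varrho}{\tau}(s'\varrho-1)$, $e_1=-\frac{\varrho}{\tau}(s'\tau-q^2)$, $c_2=-\frac{\tau}{\varrho}(s'\varrho-1)$, $e_2=-q^2\frac{\tau}{\varrho}(s'\tau-q^2)$, $c_3=s\varrho-1$, $d_3=-q^{-2}\varrho$, $e_3=q^2(s\tau-1)$, $f_3=-\tau$. A one-form $\eta$ *quasi-commutes* with $x\in X$ if $\eta x=C\,x\eta$ for some $C\in\mathbb C$ (depending on $x$). In each of these calculi, an invariant one-form that quasi-commutes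 with all generators $z_i,z_i^*$ quasi-commutes with all homogeneous $x\in X$; call it *quasi-commuting*. The nonzero quasi-commuting invariant one-forms, up to scalar multiples, are the following. 1. In $\Gamma_{\alpha\tau}$, and in $\Gamma'_{\alpha\omega}$ with real $\alpha$, there is exactly one: $H_++\alpha^{-1}H_-$. 2. In $\Gamma''_{\omega\psi}$ they are the forms $H_++\lambda H_-$, where $\lambda\in\mathbb C$ runs through the roots of $q^{-4}\omega\lambda^2-q^{-2}\omega\psi\lambda+1=0$. There are exactly two of them if $\omega\psi^2\ne4$, and exactly one (double root) if $\omega\psi^2=4$. 3. In $\Gamma'''_{\varrho\tau}$ with $\tau/\varrho\ne q^2$ there are exactly two. One is $H_++q^2\frac{\tau}{\varrho}H_-$; the other is $H_-$ if $s'\varrho=1$, and $H_++\lambda_2H_-$ with $\lambda_2=q^2(s'\tau-q^2)/(s'\varrho-1)$ otherwise. 4. In $\Gamma'''_{\varrho\tau}$ with $\varrho=q^{-2}\tau\ne s'^{-1}$ there is exactly one: $H_++q^4H_-$. 5. In $\Gamma'''_{\varrho\tau}$ with $\varrho=q^{-2}\tau=s'^{-1}$ every invariant one-form is quasi-commuting.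 -/

import Mathlib

open scoped RightActions

namespace QuantumSphere

/-! ### The algebra of the quantum sphere -/

/-- The deformation abbreviation `Q = q - q⁻¹`. -/
noncomputable def defQ (q : ℝ) : ℂ := (q : ℂ) - (q : ℂ)⁻¹

/-- `s₊ = ∑_{i=0}^{N-1} q^{2i}`. -/
noncomputable def sPlus (N : ℕ) (q : ℝ) : ℝ := ∑ i ∈ Finset.range N, q ^ (2 * i)

/-- `s₊' = s₊ - 1`. -/
noncomputable def sPlus' (N : ℕ) (q : ℝ) : ℝ := sPlus N q - 1

/-- The generator `z_i` of the free algebra (the index `i : Fin N` stands for `i + 1`). -/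
noncomputable def freeZ {N : ℕ} (i : Fin N) : FreeAlgebra ℂ (Fin N ⊕ Fin N) :=
  FreeAlgebra.ι ℂ (Sum.inl i)

/-- The generator `z*_i` of the free algebra. -/
noncomputable def freeZs {N : ℕ} (i : Fin N) : FreeAlgebra ℂ (Fin N ⊕ Fin N) :=
  FreeAlgebra.ι ℂ (Sum.inr i)

/-- The defining relations of the quantum sphere `S_q^{2N-1}`. -/
inductive Rel (N : ℕ) (q : ℝ) :
    FreeAlgebra ℂ (Fin N ⊕ Fin N) → FreeAlgebra ℂ (Fin N ⊕ Fin N) → Prop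
  | z_z (i j : Fin N) (h : i < j) :
      Rel N q (freeZ i * freeZ j) ((q : ℂ) • (freeZ j * freeZ i))
  | zs_zs (i j : Fin N) (h : i < j) :
      Rel N q (freeZs i * freeZs j) ((q : ℂ)⁻¹ • (freeZs j * freeZs i))
  | z_zs (i j : Fin N) (h : i ≠ j) :
      Rel N q (freeZ i * freeZs j) ((q : ℂ) • (freeZs j * freeZ i))
  | z_zs_self (i : Fin N) :
      Rel N q
        (freeZ i * freeZs i - freeZs i * freeZ i
          + ((q : ℂ)⁻¹ * defQ q) • ∑ k ∈ Finset.Ioi i, freeZ k * freeZs k) 0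
  | sphere : Rel N q (∑ i, freeZ i * freeZs i) 1

/-- The coordinate algebra `X` of the quantum sphere `S_q^{2N-1}`. -/
def Sphere (N : ℕ) (q : ℝ) : Type := RingQuot (Rel N q)

noncomputable instance (N : ℕ) (q : ℝ) : Ring (Sphere N q) :=
  inferInstanceAs (Ring (RingQuot (Rel N q)))

noncomputable instance (N : ℕ) (q : ℝ) : Algebra ℂ (Sphere N q) :=
  inferInstanceAs (Algebra ℂ (RingQuot (Rel N q)))

/-- The quotient map from the free algebra. -/
noncomputable def mk (N : ℕ) (q : ℝ) : FreeAlgebra ℂ (Fin N ⊕ Fin N) →ₐ[ℂ] Sphere N q :=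
  RingQuot.mkAlgHom ℂ (Rel N q)

/-- The generators: `gen (inl i) = z_i` and `gen (inr i) = z*_i`. -/
noncomputable def gen {N : ℕ} {q : ℝ} (a : Fin N ⊕ Fin N) : Sphere N q :=
  mk N q (FreeAlgebra.ι ℂ a)

/-- The generator `z_i` of the quantum sphere. -/
noncomputable def z {N : ℕ} {q : ℝ} (i : Fin N) : Sphere N q := gen (Sum.inl i)

/-- The generator `z*_i` of the quantum sphere. -/
noncomputable def zs {N : ℕ} {q : ℝ} (i : Fin N) : Sphere N q := gen (Sum.inr i)

/-- The degree of a generator: `1` for `z_i`, `-1` for `z*_i`. -/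
def genDegree {N : ℕ} : Fin N ⊕ Fin N → ℤ := Sum.elim (fun _ => 1) (fun _ => -1)

/-- The elements of `X` that are homogeneous of degree `n`: the linear combinations of monomials
in the generators in which the number of factors `z_i` minus the number of factors `z*_i` is `n`. -/
noncomputable def homogeneous (N : ℕ) (q : ℝ) (n : ℤ) : Submodule ℂ (Sphere N q) :=
  Submodule.span ℂ {x | ∃ w : List (Fin N ⊕ Fin N),
    (w.map genDegree).sum = n ∧ x = (w.map gen).prod}

/-! ### R-matrices

The first two arguments are the upper indices, the last two the lower ones. -/

section RMatrices

variable {N : ℕ} (q : ℝ)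

/-- The R-matrix `R^{ij}_{kl}`. -/
noncomputable def rMat (i j k l : Fin N) : ℂ :=
  if i = l ∧ l ≠ k ∧ k = j then 1
  else if i = j ∧ j = k ∧ k = l then (q : ℂ)
  else if i = k ∧ k < j ∧ j = l then defQ q
  else 0

/-- The inverse R-matrix `(R⁻)^{ij}_{kl}`. -/
noncomputable def rMatInv (i j k l : Fin N) : ℂ :=
  if i = l ∧ l ≠ k ∧ k = j then 1
  else if i = j ∧ j = k ∧ k = l then (q : ℂ)⁻¹
  else if i = k ∧ j < k ∧ j = l then -defQ q
  else 0

/-- `Rᶜ^{ij}_{kl} = R^{lk}_{ji}`. -/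
noncomputable def rMatC (i j k l : Fin N) : ℂ := rMat q l k j i

/-- `(R_l⁻)^{ij}_{kl} = q^{2l-2i} (R⁻)^{jl}_{ik}`. -/
noncomputable def rMatLInv (i j k l : Fin N) : ℂ :=
  (q : ℂ) ^ (2 * (l : ℤ) - 2 * (i : ℤ)) * rMatInv q j l i k

/-- `R_r^{ij}_{kl} = R^{ki}_{lj}`. -/
noncomputable def rMatR (i j k l : Fin N) : ℂ := rMat q k i l j

end RMatrices

/-! ### First order differential calculi -/

section Calculus

variable {N : ℕ} {q : ℝ} {Γ : Type*} [AddCommGroup Γ] [Module ℂ Γ]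
  [Module (Sphere N q) Γ] [Module (Sphere N q)ᵐᵒᵖ Γ]

/-- `(Γ, d)` is a first order differential calculus: the Leibniz rule holds and `Γ` is the
linear span of the elements `x dy`. The right action of `y` on `ω` is written `ω <• y`. -/
structure IsFODC (d : Sphere N q →ₗ[ℂ] Γ) : Prop where
  leibniz : ∀ x y : Sphere N q, d (x * y) = d x <• y + x • d y
  span_eq_top : Submodule.span ℂ {ω : Γ | ∃ x y : Sphere N q, ω = x • d y} = ⊤

/-- The differentials `dz_1, …, dz_N, dz*_1, …, dz*_N` form a free left module basis of `Γ`. -/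
structure IsFreelyGenerated (d : Sphere N q →ₗ[ℂ] Γ) : Prop where
  linearIndependent : LinearIndependent (Sphere N q) (fun a : Fin N ⊕ Fin N => d (gen a))
  span_eq_top :
    Submodule.span (Sphere N q) (Set.range (fun a : Fin N ⊕ Fin N => d (gen a))) = ⊤

/-- `H₊ = ∑ z_i dz*_i`. -/
noncomputable def hPlus (d : Sphere N q →ₗ[ℂ] Γ) : Γ :=
  ∑ i : Fin N, z (q := q) i • d (zs i)

/-- `H₋ = ∑ q^{-2i} z*_i dz_i`, the sum being over `i = 1, …, N`. -/
noncomputable def hMinus (d : Sphere N q →ₗ[ℂ] Γ) : Γ :=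
  ∑ i : Fin N, (q : ℂ) ^ (-2 * ((i : ℤ) + 1)) • (zs (q := q) i • d (z i))

/-- The coefficients in the formulas for the bimodule structure; see `HasBimoduleStructure`. -/
structure Coeffs where
  (a₁ b₁ c₁ e₁ : ℂ)
  (a₂ b₂ c₂ e₂ : ℂ)
  (a₃ b₃ c₃ d₃ e₃ f₃ : ℂ)
  (a₄ b₄ c₄ d₄ e₄ f₄ : ℂ)

/-- The bimodule structure of `(Γ, d)` is given by the formulas with coefficients `t`. -/
structure HasBimoduleStructure (t : Coeffs) (d : Sphere N q →ₗ[ℂ] Γ) : Prop where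
  dz_z : ∀ k l : Fin N, d (z k) <• (z l : Sphere N q) =
    t.a₁ • (∑ i, ∑ j, rMatInv q i j k l • (z (q := q) i • d (z j)))
      + t.b₁ • (z (q := q) k • d (z l))
      + t.c₁ • ((z k * z l : Sphere N q) • hPlus d)
      + t.e₁ • ((z k * z l : Sphere N q) • hMinus d)
  dzs_zs : ∀ k l : Fin N, d (zs k) <• (zs l : Sphere N q) =
    t.a₂ • (∑ i, ∑ j, rMatC q i j k l • (zs (q := q) i • d (zs j)))
      + t.b₂ • (zs (q := q) k • d (zs l))
      + t.c₂ • ((zs k * zs l : Sphere N q) • hPlus d)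
      + t.e₂ • ((zs k * zs l : Sphere N q) • hMinus d)
  dz_zs : ∀ k l : Fin N, d (z k) <• (zs l : Sphere N q) =
    t.a₃ • (∑ i, ∑ j, rMatLInv q i j k l • (zs (q := q) i • d (z j)))
      + t.b₃ • (z (q := q) k • d (zs l))
      + t.c₃ • ((z k * zs l : Sphere N q) • hPlus d)
      + (t.d₃ * (if k = l then (q : ℂ) ^ (2 * ((k : ℕ) + 1)) else 0)) • hPlus d
      + t.e₃ • ((z k * zs l : Sphere N q) • hMinus d)
      + (t.f₃ * (if k = l then (q : ℂ) ^ (2 * ((k : ℕ) + 1)) else 0)) • hMinus d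
  dzs_z : ∀ k l : Fin N, d (zs k) <• (z l : Sphere N q) =
    t.a₄ • (∑ i, ∑ j, rMatR q i j k l • (z (q := q) i • d (zs j)))
      + t.b₄ • (zs (q := q) k • d (z l))
      + t.c₄ • ((zs k * z l : Sphere N q) • hPlus d)
      + (t.d₄ * (if k = l then 1 else 0)) • hPlus d
      + t.e₄ • ((zs k * z l : Sphere N q) • hMinus d)
      + (t.f₄ * (if k = l then 1 else 0)) • hMinus d

/-- `(Γ, d)` is the freely generated first order differential calculus on the quantum sphere
whose bimodule structure has the coefficients `t` (this determines it up to isomorphism). -/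
structure IsCalculus (t : Coeffs) (d : Sphere N q →ₗ[ℂ] Γ) : Prop where
  isFODC : IsFODC d
  isFreelyGenerated : IsFreelyGenerated d
  hasBimoduleStructure : HasBimoduleStructure t d

/-- The space of invariant one-forms `μ H₊ + λ H₋`. -/
noncomputable def invariantForms (d : Sphere N q →ₗ[ℂ] Γ) : Submodule ℂ Γ :=
  Submodule.span ℂ {hPlus d, hMinus d}

/-- The one-form `η` quasi-commutes with `x`: one has `η x = C x η` for some number `C`. -/
def QuasiCommutes (η : Γ) (x : Sphere N q) : Prop :=
  ∃ C : ℂ, η <• x = C • (x • η)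

variable (N q) in
/-- The one-form `η` quasi-commutes with all generators `z_i`, `z*_i`. -/
def QuasiCommutesGenerators (η : Γ) : Prop :=
  ∀ a : Fin N ⊕ Fin N, QuasiCommutes η (gen a : Sphere N q)

variable (N q) in
/-- The one-form `η` quasi-commutes with all homogeneous elements, in particular with all
monomials in the generators. -/
def QuasiCommutesHomogeneous (η : Γ) : Prop :=
  ∀ n : ℤ, ∀ x ∈ homogeneous N q n, QuasiCommutes η x

/-- The nonzero quasi-commuting invariant one-forms up to scalar multiples: the lines they span. -/
def quasiLines (d : Sphere N q →ₗ[ℂ] Γ) : Set (Submodule ℂ Γ) :=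
  {L | ∃ η ∈ invariantForms d, η ≠ 0 ∧ QuasiCommutesGenerators N q η ∧ L = Submodule.span ℂ {η}}

end Calculus

/-! ### The four families of calculi -/

section Families

variable (N : ℕ) (q : ℝ)

/-- The calculus `Γ_{ατ}`. -/
noncomputable def gammaCoeffs (α τ : ℝ) : Coeffs where
  a₁ := q * α
  b₁ := q ^ 2 * α - 1
  c₁ := q ^ 2 * α ^ 2 * (1 - sPlus' N q * τ)
  e₁ := q ^ 2 * (1 - α * sPlus' N q * τ)
  a₂ := (q : ℂ)⁻¹ * (α : ℂ)⁻¹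
  b₂ := ((q : ℂ) ^ 2)⁻¹ * (α : ℂ)⁻¹ - 1
  c₂ := 1 - sPlus' N q * τ
  e₂ := ((α : ℂ) ^ 2)⁻¹ * (1 - α * sPlus' N q * τ)
  a₃ := (q : ℂ)⁻¹ * (α : ℂ)⁻¹
  b₃ := q ^ 2 * α - 1
  c₃ := -(q ^ 2 * α * (1 - sPlus N q * τ))
  d₃ := -(α * τ)
  e₃ := -((α : ℂ)⁻¹ * (1 - q ^ 2 * α * sPlus N q * τ))
  f₃ := -τ
  a₄ := q * α
  b₄ := ((q : ℂ) ^ 2)⁻¹ * (α : ℂ)⁻¹ - 1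
  c₄ := -(q ^ 2 * α * (1 - sPlus N q * τ))
  d₄ := -(q ^ (2 * N) * α * τ)
  e₄ := -((α : ℂ)⁻¹ * (1 - q ^ 2 * α * sPlus N q * τ))
  f₄ := -(q ^ (2 * N) * τ)

/-- The calculus `Γ'_{αω}` for real `α`. -/
noncomputable def gammaPrimeCoeffs (α ω : ℝ) : Coeffs where
  a₁ := q * α
  b₁ := q ^ 2 * α - 1
  c₁ := ω
  e₁ := (α : ℂ)⁻¹ * ω - q ^ 2 * (α - 1)
  a₂ := (q : ℂ)⁻¹ * (α : ℂ)⁻¹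
  b₂ := ((q : ℂ) ^ 2)⁻¹ * (α : ℂ)⁻¹ - 1
  c₂ := q ^ 2 * α * (ω : ℂ)⁻¹ - ((α : ℂ)⁻¹ - 1)
  e₂ := q ^ 2 * (ω : ℂ)⁻¹
  a₃ := (q : ℂ)⁻¹ * (α : ℂ)⁻¹
  b₃ := q ^ 2 * α - 1
  c₃ := -(q ^ 2 * α)
  d₃ := 0
  e₃ := -(α : ℂ)⁻¹
  f₃ := 0
  a₄ := q * α
  b₄ := ((q : ℂ) ^ 2)⁻¹ * (α : ℂ)⁻¹ - 1
  c₄ := -(q ^ 2 * α)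
  d₄ := 0
  e₄ := -(α : ℂ)⁻¹
  f₄ := 0

/-- The calculus `Γ''_{ωψ}`. -/
noncomputable def gammaSecondCoeffs (ω ψ : ℝ) : Coeffs where
  a₁ := (q : ℂ)⁻¹
  b₁ := 0
  c₁ := ω
  e₁ := q ^ 2 * ω * ψ - 1
  a₂ := q
  b₂ := 0
  c₂ := ψ - q ^ 2
  e₂ := q ^ 2 * (ω : ℂ)⁻¹
  a₃ := q
  b₃ := 0
  c₃ := -1
  d₃ := 0
  e₃ := -q ^ 2
  f₃ := 0
  a₄ := (q : ℂ)⁻¹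
  b₄ := 0
  c₄ := -1
  d₄ := 0
  e₄ := -q ^ 2
  f₄ := 0

/-- The calculus `Γ'''_{ϱτ}`. -/
noncomputable def gammaThirdCoeffs (ϱ τ : ℝ) : Coeffs where
  a₁ := (q : ℂ)⁻¹
  b₁ := 0
  c₁ := -(((q : ℂ) ^ 2)⁻¹ * (ϱ / τ) * (sPlus' N q * ϱ - 1))
  e₁ := -((ϱ / τ) * (sPlus' N q * τ - q ^ 2))
  a₂ := q
  b₂ := 0
  c₂ := -((τ / ϱ) * (sPlus' N q * ϱ - 1))
  e₂ := -(q ^ 2 * (τ / ϱ) * (sPlus' N q * τ - q ^ 2))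
  a₃ := q
  b₃ := 0
  c₃ := sPlus N q * ϱ - 1
  d₃ := -(((q : ℂ) ^ 2)⁻¹ * ϱ)
  e₃ := q ^ 2 * (sPlus N q * τ - 1)
  f₃ := -τ
  a₄ := (q : ℂ)⁻¹
  b₄ := 0
  c₄ := sPlus N q * ϱ - 1
  d₄ := -(q ^ (2 * (N : ℤ) - 2) * ϱ)
  e₄ := q ^ 2 * (sPlus N q * τ - 1)
  f₄ := -(q ^ (2 * N) * τ)

end Families

end QuantumSphere

/-! The span of `H₊` and `H₋` is two-dimensional, and quasi-commutation with the generators is an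
eigenvector condition in it. Contracting the bimodule relations with `z_k` or `q^{-2k} z*_k` makes
every R-matrix collapse, by the relations of `X` together with `∑ z_k z*_k = 1` and `∑ q^{-2k} z*_k
z_k = q^{-2}`. Hence, for each generator `x`, the product `H_± x` is a combination of `x H₊`, `x H₋`
and `dx` whose scalars depend only on whether `x` is some `z_i` or some `z*_i` (`hPlus_z`,
`hMinus_z`, `hPlus_zs`, `hMinus_zs`).

For `x` of index 1 these three forms are linearly independent over `ℂ` (`coeffs_eq_zero`): in the
free basis this reduces to `z_1 z_2 ≠ 0` and its starred variants, which an explicit representation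
on `ℤ → ℂ` detects. So quasi-commutation is equivalent to the six scalar equations of `IsQuasiPair`
(`quasiCommutesGenerators_iff`). Moving a nonzero form past the sphere relation forces `C C' = 1`,
so an element of degree `n` contributes the factor `C ^ n`.

It remains to solve the equations. If `q²α ≠ 1`, the `dx` equation alone fixes the ratio `λ/μ =
α⁻¹`. In `Γ''` and `Γ'''` all `b_i` vanish; eliminating `C` leaves a quadratic in `λ`, and
eliminating `C'` leaves the same quadratic up to a factor. For `Γ'''` it splits into linear factors,
and the exceptional cases are those where a root goes to infinity, the roots coincide, or the
quadratic vanishes identically. -/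

namespace QuantumSphere

/-! ### Relations in the quantum sphere -/

section Relations

variable {N : ℕ} {q : ℝ}

theorem mk_eq_of_rel {x y : FreeAlgebra ℂ (Fin N ⊕ Fin N)} (h : Rel N q x y) :
    mk N q x = mk N q y :=
  RingQuot.mkAlgHom_rel ℂ h

theorem mk_freeZ (i : Fin N) : mk N q (freeZ i) = z i := rfl

theorem mk_freeZs (i : Fin N) : mk N q (freeZs i) = zs i := rfl

theorem z_mul_z {i j : Fin N} (h : i < j) :
    (z i * z j : Sphere N q) = (q : ℂ) • (z j * z i) := by
  simpa only [map_mul, map_smul, mk_freeZ] using mk_eq_of_rel (q := q) (Rel.z_z i j h)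

theorem zs_mul_zs {i j : Fin N} (h : i < j) :
    (zs i * zs j : Sphere N q) = (q : ℂ)⁻¹ • (zs j * zs i) := by
  simpa only [map_mul, map_smul, mk_freeZs] using mk_eq_of_rel (q := q) (Rel.zs_zs i j h)

theorem z_mul_zs {i j : Fin N} (h : i ≠ j) :
    (z i * zs j : Sphere N q) = (q : ℂ) • (zs j * z i) := by
  simpa only [map_mul, map_smul, mk_freeZ, mk_freeZs] using mk_eq_of_rel (q := q) (Rel.z_zs i j h)

theorem zs_mul_z_self (i : Fin N) :
    (zs i * z i : Sphere N q) =
      z i * zs i + ((q : ℂ)⁻¹ * defQ q) • ∑ k ∈ Finset.Ioi i, z k * zs k := by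
  have h := mk_eq_of_rel (q := q) (Rel.z_zs_self i)
  simp only [map_add, map_sub, map_mul, map_smul, map_sum, map_zero, mk_freeZ, mk_freeZs] at h
  rw [sub_add_eq_add_sub, sub_eq_zero] at h
  exact h.symm

theorem sum_z_mul_zs : (∑ i : Fin N, z i * zs i : Sphere N q) = 1 := by
  simpa only [map_sum, map_mul, map_one, mk_freeZ, mk_freeZs] using mk_eq_of_rel (q := q) Rel.sphere

theorem inv_mul_defQ (hq : q ≠ 0) : (q : ℂ)⁻¹ * defQ q = 1 - ((q : ℂ) ^ 2)⁻¹ := by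
  have : (q : ℂ) ≠ 0 := by exact_mod_cast hq
  unfold defQ
  field_simp

/-- The weight `q^{-2i}`, for the one-based value of the index `i`. -/
noncomputable def weight (q : ℝ) (i : ℕ) : ℂ := (q : ℂ) ^ (-2 * ((i : ℤ) + 1))

theorem weight_succ (hq : q ≠ 0) (i : ℕ) : weight q (i + 1) = ((q : ℂ) ^ 2)⁻¹ * weight q i := by
  have : (q : ℂ) ≠ 0 := by exact_mod_cast hq
  unfold weight
  rw [show ((-2 : ℤ) * (((i + 1 : ℕ) : ℤ) + 1)) = -2 + -2 * ((i : ℤ) + 1) by push_cast; ring,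
    zpow_add₀ this]
  rfl

theorem weight_zero : weight q 0 = ((q : ℂ) ^ 2)⁻¹ := by
  unfold weight
  norm_num

theorem weight_ne_zero (hq : q ≠ 0) (i : ℕ) : weight q i ≠ 0 :=
  zpow_ne_zero _ (by exact_mod_cast hq)

theorem weight_mul_pow (hq : q ≠ 0) (i : ℕ) : weight q i * (q : ℂ) ^ (2 * (i + 1)) = 1 := by
  have : (q : ℂ) ≠ 0 := by exact_mod_cast hq
  unfold weight
  rw [← zpow_natCast, ← zpow_add₀ this]
  push_cast
  ring_nf
  simp

/-- Downward induction on `m`. Reordering `z*_m z_m` adds `1 - q^{-2}` times the tail, the inductive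
hypothesis supplies `q^{-2}` times the same tail, and the two add up to the tail itself. Partial
sums are kept because the tails `k > l` occur in the diagonal contractions. -/
theorem sum_filter_weight_smul (hq : q ≠ 0) (m : ℕ) (hm : m ≤ N) :
    ∑ k ∈ Finset.univ.filter fun k : Fin N => m ≤ (k : ℕ), weight q k • (zs k * z k : Sphere N q) =
      weight q m • ∑ k ∈ Finset.univ.filter fun k : Fin N => m ≤ (k : ℕ), z k * zs k := by
  induction hm using Nat.decreasingInduction with
  | self =>
    have : (Finset.univ.filter fun k : Fin N => N ≤ (k : ℕ)) = ∅ := by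
      ext k
      simp
    simp [this]
  | of_succ m hm ih =>
    have h1 : (Finset.univ.filter fun k : Fin N => m ≤ (k : ℕ)) =
        insert ⟨m, hm⟩ (Finset.univ.filter fun k : Fin N => m + 1 ≤ (k : ℕ)) := by
      ext k
      simp only [Finset.mem_filter, Finset.mem_univ, true_and, Finset.mem_insert, Fin.ext_iff]
      omega
    have h2 : Finset.Ioi (⟨m, hm⟩ : Fin N) =
        Finset.univ.filter fun k : Fin N => m + 1 ≤ (k : ℕ) := by
      ext k
      simp only [Finset.mem_Ioi, Finset.mem_filter, Finset.mem_univ, true_and, Fin.lt_def,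
        Nat.succ_le_iff]
    rw [h1, Finset.sum_insert (by simp), Finset.sum_insert (by simp), ih, zs_mul_z_self, h2,
      inv_mul_defQ hq, weight_succ hq]
    module

theorem sum_weight_smul (hq : q ≠ 0) :
    ∑ k : Fin N, weight q k • (zs k * z k : Sphere N q) = ((q : ℂ) ^ 2)⁻¹ • 1 := by
  have := sum_filter_weight_smul (N := N) hq 0 (Nat.zero_le _)
  simpa [sum_z_mul_zs, weight_zero] using this

theorem sum_Ioi_weight_smul (hq : q ≠ 0) (l : Fin N) :
    ∑ k ∈ Finset.Ioi l, weight q k • (zs k * z k : Sphere N q) =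
      (((q : ℂ) ^ 2)⁻¹ * weight q l) • ∑ k ∈ Finset.Ioi l, z k * zs k := by
  have h2 : Finset.Ioi l = Finset.univ.filter fun k : Fin N => (l : ℕ) + 1 ≤ (k : ℕ) := by
    ext k
    simp only [Finset.mem_Ioi, Finset.mem_filter, Finset.mem_univ, true_and, Fin.lt_def,
        Nat.succ_le_iff]
  rw [h2, sum_filter_weight_smul hq _ l.2, weight_succ hq]

end Relations

/-! ### Contractions with the R-matrices -/

section Contractions

variable {N : ℕ} {q : ℝ} {M : Type*} [AddCommGroup M] [Module ℂ M]

/-- This and the next seven lemmas record sparsity. For `j ≠ l` at most two pairs `(k, i)`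
contribute; for `j = l` only `(l, l)` does, joined for `rMatInv` and `rMatC` by the diagonal tail `k
= i > l`. -/
theorem sum_rMatR_smul_of_ne {j l : Fin N} (h : j ≠ l) (f : Fin N → Fin N → M) :
    ∑ k, ∑ i, rMatR q i j k l • f k i = f j l + (if l < j then defQ q else 0) • f l j := by
  have key (k i : Fin N) : rMatR q i j k l =
      (if k = j then if i = l then 1 else 0 else 0) +
        if k = l then if i = j then (if l < j then defQ q else 0) else 0 else 0 := by
    unfold rMatR rMat
    grind
  simp [key, add_smul, ite_smul, Finset.sum_add_distrib]

theorem sum_rMatR_smul_self (l : Fin N) (f : Fin N → Fin N → M) :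
    ∑ k, ∑ i, rMatR q i l k l • f k i = (q : ℂ) • f l l := by
  have key (k i : Fin N) : rMatR q i l k l = if k = l then if i = l then (q : ℂ) else 0 else 0 := by
    unfold rMatR rMat
    grind
  simp [key, ite_smul]

theorem sum_rMatInv_smul_of_ne {j l : Fin N} (h : j ≠ l) (f : Fin N → Fin N → M) :
    ∑ k, ∑ i, rMatInv q i j k l • f k i = f j l := by
  have key (k i : Fin N) : rMatInv q i j k l = if k = j then if i = l then 1 else 0 else 0 := by
    unfold rMatInv
    grind
  simp [key, ite_smul]

theorem sum_rMatInv_smul_self (l : Fin N) (f : Fin N → Fin N → M) :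
    ∑ k, ∑ i, rMatInv q i l k l • f k i =
      (q : ℂ)⁻¹ • f l l - defQ q • ∑ k ∈ Finset.Ioi l, f k k := by
  have key (k i : Fin N) : rMatInv q i l k l =
      (if k = l then if i = l then (q : ℂ)⁻¹ else 0 else 0) +
        if i = k then (if l < k then -defQ q else 0) else 0 := by
    unfold rMatInv
    grind
  have hs : Finset.univ.filter (fun k => l < k) = Finset.Ioi l := by
    ext k
    simp
  simp [key, add_smul, ite_smul, Finset.sum_add_distrib, ← Finset.sum_filter, hs, Finset.smul_sum,
    sub_eq_add_neg]

theorem sum_rMatC_smul_of_ne {j l : Fin N} (h : j ≠ l) (f : Fin N → Fin N → M) :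
    ∑ k, ∑ i, rMatC q i j k l • f k i = f j l := by
  have key (k i : Fin N) : rMatC q i j k l = if k = j then if i = l then 1 else 0 else 0 := by
    unfold rMatC rMat
    grind
  simp [key, ite_smul]

theorem sum_rMatC_smul_self (l : Fin N) (f : Fin N → Fin N → M) :
    ∑ k, ∑ i, rMatC q i l k l • f k i =
      (q : ℂ) • f l l + defQ q • ∑ k ∈ Finset.Ioi l, f k k := by
  have key (k i : Fin N) : rMatC q i l k l =
      (if k = l then if i = l then (q : ℂ) else 0 else 0) +
        if i = k then (if l < k then defQ q else 0) else 0 := by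
    unfold rMatC rMat
    grind
  have hs : Finset.univ.filter (fun k => l < k) = Finset.Ioi l := by
    ext k
    simp
  simp [key, add_smul, ite_smul, Finset.sum_add_distrib, ← Finset.sum_filter, hs, Finset.smul_sum]

theorem sum_rMatLInv_smul_of_ne {j l : Fin N} (h : j ≠ l) (f : Fin N → Fin N → M) :
    ∑ k, ∑ i, rMatLInv q i j k l • f k i =
      f j l - (if l < j then (q : ℂ) ^ (2 * (l : ℤ) - 2 * (j : ℤ)) * defQ q else 0) • f l j := by
  have key (k i : Fin N) : rMatLInv q i j k l =
      (if k = j then if i = l then 1 else 0 else 0) +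
        if k = l then if i = j then
          (if l < j then -((q : ℂ) ^ (2 * (l : ℤ) - 2 * (j : ℤ)) * defQ q) else 0)
          else 0 else 0 := by
    unfold rMatLInv rMatInv
    by_cases h1 : i = l
    · subst h1
      simp only [sub_self, zpow_zero]
      grind
    · grind
  simp only [key, add_smul, ite_smul, Finset.sum_add_distrib]
  split_ifs <;> simp [sub_eq_add_neg]

theorem sum_rMatLInv_smul_self (l : Fin N) (f : Fin N → Fin N → M) :
    ∑ k, ∑ i, rMatLInv q i l k l • f k i = (q : ℂ)⁻¹ • f l l := by
  have key (k i : Fin N) : rMatLInv q i l k l =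
      if k = l then if i = l then (q : ℂ)⁻¹ else 0 else 0 := by
    unfold rMatLInv rMatInv
    by_cases h1 : i = l
    · subst h1
      simp only [sub_self, zpow_zero]
      grind
    · grind
  simp [key, ite_smul]

/-- The generators `z` are eigenvectors for the braiding: in the case `l < j` the two surviving
terms combine through `1 + qQ = q²`. -/
theorem sum_rMatR_z_mul_z (hq : q ≠ 0) (j l : Fin N) :
    ∑ k, ∑ i, rMatR q i j k l • (z k * z i : Sphere N q) = (q : ℂ) • (z l * z j) := by
  have hq' : (q : ℂ) ≠ 0 := by exact_mod_cast hq
  rcases lt_trichotomy j l with h | rfl | h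
  · rw [sum_rMatR_smul_of_ne h.ne, if_neg h.not_gt, z_mul_z h, zero_smul, add_zero]
  · exact sum_rMatR_smul_self _ _
  · rw [sum_rMatR_smul_of_ne h.ne', if_pos h, z_mul_z h, smul_smul, smul_smul,
      ← one_smul ℂ (z j * z l), smul_smul, smul_smul, ← add_smul]
    congr 1
    unfold defQ
    field_simp
    ring

/-- On the diagonal, reordering `z*_j z_j` produces `q^{-2} Q` times the weighted tail, and the tail
of the R-matrix cancels it. The weights `q^{-2k}` in `H₋` are what makes this exact. -/
theorem sum_rMatInv_zs_mul_z (hq : q ≠ 0) (j l : Fin N) :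
    ∑ k, ∑ i, rMatInv q i j k l • (weight q k • (zs k * z i : Sphere N q)) =
      ((q : ℂ)⁻¹ * weight q j) • (z l * zs j) := by
  have hq' : (q : ℂ) ≠ 0 := by exact_mod_cast hq
  by_cases h : j = l
  · subst h
    rw [sum_rMatInv_smul_self j fun k i => weight q k • (zs k * z i : Sphere N q),
      sum_Ioi_weight_smul hq, zs_mul_z_self]
    unfold defQ
    match_scalars
    · field_simp
    · field_simp
      ring
  · rw [sum_rMatInv_smul_of_ne h fun k i => weight q k • (zs k * z i : Sphere N q),
      z_mul_zs (Ne.symm h), smul_smul]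
    congr 1
    field_simp

theorem sum_rMatC_z_mul_zs (hq : q ≠ 0) (j l : Fin N) :
    ∑ k, ∑ i, rMatC q i j k l • (z k * zs i : Sphere N q) = (q : ℂ) • (zs l * z j) := by
  have hq' : (q : ℂ) ≠ 0 := by exact_mod_cast hq
  by_cases h : j = l
  · subst h
    rw [sum_rMatC_smul_self j fun k i => (z k * zs i : Sphere N q), zs_mul_z_self, smul_add,
      smul_smul, ← mul_assoc, mul_inv_cancel₀ hq', one_mul]
  · rw [sum_rMatC_smul_of_ne h fun k i => (z k * zs i : Sphere N q), z_mul_zs h]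

/-- For `l < j` the prefactor `q^{2l-2j}` converts the weight of `l` into that of `j`; the rest is
`q - Q = q⁻¹`. -/
theorem sum_rMatLInv_zs_mul_zs (hq : q ≠ 0) (j l : Fin N) :
    ∑ k, ∑ i, rMatLInv q i j k l • (weight q k • (zs k * zs i : Sphere N q)) =
      ((q : ℂ)⁻¹ * weight q j) • (zs l * zs j) := by
  have hq' : (q : ℂ) ≠ 0 := by exact_mod_cast hq
  rcases lt_trichotomy j l with h | rfl | h
  · rw [sum_rMatLInv_smul_of_ne h.ne fun k i => weight q k • (zs k * zs i : Sphere N q),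
      if_neg h.not_gt, zs_mul_zs h]
    module
  · rw [sum_rMatLInv_smul_self j fun k i => weight q k • (zs k * zs i : Sphere N q), smul_smul]
  · rw [sum_rMatLInv_smul_of_ne h.ne' fun k i => weight q k • (zs k * zs i : Sphere N q),
      if_pos h, zs_mul_zs h]
    have hw : (q : ℂ) ^ (2 * (l : ℤ) - 2 * (j : ℤ)) * weight q l = weight q j := by
      unfold weight
      rw [← zpow_add₀ hq']
      ring_nf
    have : (q : ℂ) ^ (2 * (l : ℤ) - 2 * (j : ℤ)) * defQ q * weight q l = defQ q * weight q j := by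
      rw [← hw]
      ring
    simp only [smul_smul, ← sub_smul]
    congr 1
    rw [← mul_assoc, this]
    unfold defQ
    field_simp
    ring

end Contractions

/-! ### A representation of the quantum sphere -/

section Representation

variable {N : ℕ} {q : ℝ}

/-- The operators on `ℤ → ℂ` representing the generators: `z_1` is a shift, `z_2` and `z*_2` are
diagonal, `z*_1` is a weighted shift and all the other generators act by zero. -/
noncomputable def repGen (q : ℝ) : Fin N ⊕ Fin N → Module.End ℂ (ℤ → ℂ)
  | Sum.inl i =>
    if (i : ℕ) = 0 then LinearMap.funLeft ℂ ℂ fun n => n - 1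
    else if (i : ℕ) = 1 then LinearMap.mulLeft ℂ fun n : ℤ => (q : ℂ) ^ (-n)
    else 0
  | Sum.inr i =>
    if (i : ℕ) = 0 then
      LinearMap.mulLeft ℂ (fun n : ℤ => 1 - (q : ℂ) ^ (-2 * n - 2)) ∘ₗ
        LinearMap.funLeft ℂ ℂ fun n => n + 1
    else if (i : ℕ) = 1 then LinearMap.mulLeft ℂ fun n : ℤ => (q : ℂ) ^ (-n)
    else 0

theorem repGen_inl_apply (i : Fin N) (f : ℤ → ℂ) (n : ℤ) :
    repGen q (Sum.inl i) f n =
      if (i : ℕ) = 0 then f (n - 1) else if (i : ℕ) = 1 then (q : ℂ) ^ (-n) * f n else 0 := by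
  simp only [repGen]
  split_ifs <;> rfl

theorem repGen_inr_apply (i : Fin N) (f : ℤ → ℂ) (n : ℤ) :
    repGen q (Sum.inr i) f n =
      if (i : ℕ) = 0 then (1 - (q : ℂ) ^ (-2 * n - 2)) * f (n + 1)
      else if (i : ℕ) = 1 then (q : ℂ) ^ (-n) * f n else 0 := by
  simp only [repGen]
  split_ifs <;> rfl

theorem repGen_apply_apply_eq_zero (i : Fin N) (h0 : (i : ℕ) ≠ 0) (h1 : (i : ℕ) ≠ 1)
    (f : ℤ → ℂ) (n : ℤ) : repGen q (Sum.inl i) (repGen q (Sum.inr i) f) n = 0 := by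
  rw [repGen_inl_apply, if_neg h0, if_neg h1]

/-- The weight of `z*_1` is dictated by the sphere relation: `z_1 z*_1` acts at `n` as `1 - q^{-2n}`
and `z_2 z*_2` as `q^{-2n}`. The second coordinate must exist, hence `2 ≤ N`. -/
theorem lift_repGen_rel (hN : 2 ≤ N) (hq : q ≠ 0) {x y : FreeAlgebra ℂ (Fin N ⊕ Fin N)}
    (h : Rel N q x y) :
    FreeAlgebra.lift ℂ (repGen q) x = FreeAlgebra.lift ℂ (repGen q) y := by
  have hq' : (q : ℂ) ≠ 0 := by exact_mod_cast hq
  obtain ⟨M, rfl⟩ := Nat.exists_eq_add_of_le' hN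
  induction h with
  | z_z i j h =>
    ext f n
    have h' : (i : ℕ) < j := h
    simp only [map_mul, map_smul, freeZ, FreeAlgebra.lift_ι_apply, Module.End.mul_apply,
      LinearMap.smul_apply, Pi.smul_apply, smul_eq_mul, repGen_inl_apply]
    split_ifs <;> try omega
    · rw [← mul_assoc, neg_sub, sub_eq_neg_add, zpow_add₀ hq', zpow_one]
      ring
    all_goals simp
  | zs_zs i j h =>
    ext f n
    have h' : (i : ℕ) < j := h
    simp only [map_mul, map_smul, freeZs, FreeAlgebra.lift_ι_apply, Module.End.mul_apply,
      LinearMap.smul_apply, Pi.smul_apply, smul_eq_mul, repGen_inr_apply]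
    split_ifs <;> try omega
    · rw [neg_add, zpow_add₀ hq', zpow_neg_one]
      ring
    all_goals simp
  | z_zs i j h =>
    ext f n
    have h' : (i : ℕ) ≠ j := fun h' => h (Fin.ext h')
    simp only [map_mul, map_smul, freeZ, freeZs, FreeAlgebra.lift_ι_apply, Module.End.mul_apply,
      LinearMap.smul_apply, Pi.smul_apply, smul_eq_mul, repGen_inl_apply, repGen_inr_apply]
    split_ifs <;> try omega
    · rw [← mul_assoc, neg_sub, sub_eq_neg_add, zpow_add₀ hq', zpow_one]
      ring
    · simp
    · rw [neg_add, zpow_add₀ hq', zpow_neg_one]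
      field_simp
    all_goals simp
  | z_zs_self i =>
    ext f n
    simp only [map_add, map_sub, map_mul, map_smul, map_sum, map_zero, freeZ, freeZs,
      FreeAlgebra.lift_ι_apply, Module.End.mul_apply, LinearMap.smul_apply, LinearMap.add_apply,
      LinearMap.sub_apply, LinearMap.sum_apply, Pi.smul_apply, Pi.add_apply, Pi.sub_apply,
      Finset.sum_apply, smul_eq_mul, LinearMap.zero_apply, Pi.zero_apply, inv_mul_defQ hq]
    by_cases h0 : (i : ℕ) = 0
    -- Only `z_2 z*_2` survives in the tail, and the relation at `n` becomes `(1 - q^{-2n}) - (1 -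
    -- q^{-2n-2}) + (1 - q^{-2}) q^{-2n} = 0`.
    · rw [Finset.sum_eq_single (1 : Fin (M + 2))]
      · simp only [repGen_inl_apply, repGen_inr_apply, h0, Fin.val_one, if_true, one_ne_zero,
          if_false]
        have e1 : (q : ℂ) ^ (-2 * (n - 1) - 2) = (q : ℂ) ^ (-n) * (q : ℂ) ^ (-n) := by
          rw [← zpow_add₀ hq']
          ring_nf
        have e2 : (q : ℂ) ^ (-2 * n - 2) =
            ((q : ℂ) ^ 2)⁻¹ * ((q : ℂ) ^ (-n) * (q : ℂ) ^ (-n)) := by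
          rw [← zpow_add₀ hq', show -2 * n - 2 = -2 + (-n + -n) by ring, zpow_add₀ hq']
          rfl
        rw [e1, e2]
        ring_nf
      · intro j hj hj1
        apply repGen_apply_apply_eq_zero
        · have := Fin.lt_def.1 (Finset.mem_Ioi.1 hj)
          omega
        · intro h
          exact hj1 (Fin.ext h)
      · intro h
        exact absurd (Finset.mem_Ioi.2 (Fin.lt_def.2 (by simp [h0]))) h
    · rw [Finset.sum_eq_zero]
      · simp only [repGen_inl_apply, repGen_inr_apply]
        split_ifs <;> simp
      · intro j hj
        have := Fin.lt_def.1 (Finset.mem_Ioi.1 hj)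
        apply repGen_apply_apply_eq_zero <;> omega
  | sphere =>
    ext f n
    simp only [map_mul, map_sum, map_one, freeZ, freeZs,
      FreeAlgebra.lift_ι_apply, Module.End.mul_apply, LinearMap.sum_apply,
      Finset.sum_apply, Module.End.one_apply]
    rw [Fin.sum_univ_succ, Fin.sum_univ_succ, Finset.sum_eq_zero]
    · simp only [repGen_inl_apply, repGen_inr_apply, Fin.val_zero, Fin.val_succ, if_true,
        zero_add, one_ne_zero, if_false]
      have e1 : (q : ℂ) ^ (-2 * (n - 1) - 2) = (q : ℂ) ^ (-n) * (q : ℂ) ^ (-n) := by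
        rw [← zpow_add₀ hq']
        ring_nf
      rw [e1]
      ring_nf
    · intro j _
      apply repGen_apply_apply_eq_zero <;> simp

/-- The representation of the quantum sphere on `ℤ → ℂ` given by `repGen`. -/
noncomputable def rep (hN : 2 ≤ N) (hq : q ≠ 0) : Sphere N q →ₐ[ℂ] Module.End ℂ (ℤ → ℂ) :=
  RingQuot.liftAlgHom ℂ ⟨FreeAlgebra.lift ℂ (repGen q), fun _ _ h => lift_repGen_rel hN hq h⟩

theorem rep_gen (hN : 2 ≤ N) (hq : q ≠ 0) (a : Fin N ⊕ Fin N) :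
    rep hN hq (gen a) = repGen q a := by
  refine (RingQuot.liftAlgHom_mkAlgHom_apply ℂ (FreeAlgebra.lift ℂ (repGen q))
    (fun _ _ h => lift_repGen_rel hN hq h) (FreeAlgebra.ι ℂ a)).trans ?_
  exact FreeAlgebra.lift_ι_apply _ _

theorem nontrivial_sphere (hN : 2 ≤ N) (hq : q ≠ 0) : Nontrivial (Sphere N q) :=
  (rep hN hq).toRingHom.domain_nontrivial

/-- The generators `z_i` and `z*_i` for a given index `i`. -/
def IsGenOf (i : Fin N) (a : Fin N ⊕ Fin N) : Prop := a = Sum.inl i ∨ a = Sum.inr i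

theorem gen_mul_gen_ne_zero (hN : 2 ≤ N) (hq : q ≠ 0) (hq₁ : q ≠ 1) (hq₂ : q ≠ -1)
    {a b : Fin N ⊕ Fin N} (ha : IsGenOf ⟨0, by omega⟩ a) (hb : IsGenOf ⟨1, by omega⟩ b) :
    (gen a * gen b : Sphere N q) ≠ 0 := by
  have hq' : (q : ℂ) ≠ 0 := by exact_mod_cast hq
  have hsq : (q : ℂ) ^ 2 ≠ 1 := by
    intro h
    have : q ^ 2 = 1 := by exact_mod_cast h
    rcases mul_self_eq_one_iff.1 ((sq q).symm.trans this) with h | h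
    · exact hq₁ h
    · exact hq₂ h
  intro h
  have h1 := congrArg (rep hN hq) h
  rw [map_mul, map_zero, rep_gen, rep_gen] at h1
  -- Testing on the constant function at `n = 0`: `z_1` leaves a power of `q`, and `z*_1`
  -- contributes the factor `1 - q^{-2}`, nonzero since `q ≠ ±1`.
  have h2 := congrFun (LinearMap.congr_fun h1 (fun _ => 1)) 0
  rcases ha with rfl | rfl <;> rcases hb with rfl | rfl <;>
    simp [repGen_inl_apply, repGen_inr_apply, hq'] at h2
  all_goals
    rw [sub_eq_zero] at h2
    apply hsq
    exact inv_eq_one.1 h2.symm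

end Representation

/-! ### Right multiplication of the invariant forms by the generators -/

section LeftModule

variable {N : ℕ} {q : ℝ} {Γ : Type*} [AddCommGroup Γ] [Module ℂ Γ] [Module (Sphere N q) Γ]

theorem hMinus_eq (d : Sphere N q →ₗ[ℂ] Γ) :
    hMinus d = ∑ i : Fin N, weight q i • (zs (q := q) i • d (z i)) := rfl

variable [IsScalarTower ℂ (Sphere N q) Γ]

/-- Collects the leading terms in the formula for the product of an invariant form with a
generator. -/
theorem sum_smul_sum_smul (c : Fin N → ℂ) (m : Fin N → Fin N → Fin N → ℂ)
    (u v : Fin N → Sphere N q) (ξ : Fin N → Γ) (g : Fin N → Sphere N q)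
    (h : ∀ j, ∑ k, ∑ i, m i j k • (c k • (u k * v i)) = g j) :
    ∑ k, c k • (u k • ∑ i, ∑ j, m i j k • (v i • ξ j)) = ∑ j, g j • ξ j := by
  simp only [← h, Finset.smul_sum, Finset.sum_smul]
  have (k i j : Fin N) : c k • (u k • (m i j k • (v i • ξ j))) =
      (m i j k • (c k • (u k * v i))) • ξ j := by
    rw [smul_comm (u k) (m i j k), smul_smul (u k), smul_comm (c k), smul_assoc, smul_assoc]
  simp only [this]
  exact (Finset.sum_congr rfl fun k _ => Finset.sum_comm).trans Finset.sum_comm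

/-- Collects all the terms in the formula for the product of an invariant form with a generator. -/
theorem sum_smul_bimodule (c : Fin N → ℂ) (u v : Fin N → Sphere N q) (S : Fin N → Γ)
    (δ : Fin N → ℂ) (y : Sphere N q) (ξ H K : Γ) (r a b c' d' e f : ℂ)
    (hr : ∑ k, c k • (u k * v k) = r • 1) (y' : Sphere N q)
    (hδ : ∑ k, (c k * δ k) • u k = y') :
    ∑ k, c k • (u k • (a • S k + b • (v k • ξ) + c' • ((v k * y) • H) + (d' * δ k) • H
      + e • ((v k * y) • K) + (f * δ k) • K)) =
    a • ∑ k, c k • (u k • S k) + (r * b) • ξ + ((r * c') • (y • H) + d' • (y' • H))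
      + ((r * e) • (y • K) + f • (y' • K)) := by
  have h1 (b : ℂ) (ξ : Γ) : ∑ k, c k • (u k • (b • (v k • ξ))) = (r * b) • ξ := by
    have (k : Fin N) : c k • (u k • (b • (v k • ξ))) = b • ((c k • (u k * v k)) • ξ) := by
      rw [smul_comm (u k) b, smul_comm (c k) b, smul_smul (u k), smul_assoc]
    simp only [this]
    rw [← Finset.smul_sum, ← Finset.sum_smul, hr, smul_assoc, one_smul, smul_smul, mul_comm]
  have h2 (b : ℂ) (ξ : Γ) : ∑ k, c k • (u k • ((b * δ k) • ξ)) = b • (y' • ξ) := by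
    have (k : Fin N) : c k • (u k • ((b * δ k) • ξ)) = b • (((c k * δ k) • u k) • ξ) := by
      rw [smul_comm (u k), smul_smul (c k), smul_assoc, smul_smul b]
      ring_nf
    simp only [this]
    rw [← Finset.smul_sum, ← Finset.sum_smul, hδ]
  have h3 : ∑ k, c k • (u k • (a • S k)) = a • ∑ k, c k • (u k • S k) := by
    rw [Finset.smul_sum]
    refine Finset.sum_congr rfl fun k _ => ?_
    rw [smul_comm (u k) a, smul_comm (c k) a]
  simp only [smul_add, Finset.sum_add_distrib, mul_smul (v _) y, h1, h2, h3]
  abel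

end LeftModule

section RightMultiplication

variable {N : ℕ} {q : ℝ} {Γ : Type*} [AddCommGroup Γ] [Module ℂ Γ]
  [Module (Sphere N q) Γ] [Module (Sphere N q)ᵐᵒᵖ Γ]
  [SMulCommClass (Sphere N q) (Sphere N q)ᵐᵒᵖ Γ]
  [IsScalarTower ℂ (Sphere N q)ᵐᵒᵖ Γ]

theorem op_smul_sum (c : Fin N → ℂ) (u : Fin N → Sphere N q) (ξ : Fin N → Γ) (y : Sphere N q) :
    (∑ k, c k • (u k • ξ k)) <• y = ∑ k, c k • (u k • (ξ k <• y)) := by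
  rw [Finset.smul_sum]
  refine Finset.sum_congr rfl fun k _ => ?_
  rw [smul_comm (MulOpposite.op y) (c k), smul_comm (u k)]

variable [IsScalarTower ℂ (Sphere N q) Γ] {t : Coeffs} {d : Sphere N q →ₗ[ℂ] Γ}

/-- Pattern of all four products: the R-matrix term contracts to a multiple of `x H_±`, the terms
with `b`, `c`, `e` meet the sphere relation in one of its two orderings, and the Kronecker terms
select the generator `x` itself. No scalar depends on `l`. -/
theorem HasBimoduleStructure.hPlus_z (h : HasBimoduleStructure t d) (hq : q ≠ 0) (l : Fin N) :
    hPlus d <• (z l : Sphere N q) =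
      (q * t.a₄ + t.c₄ + t.d₄) • ((z l : Sphere N q) • hPlus d)
        + (t.e₄ + t.f₄) • ((z l : Sphere N q) • hMinus d) + t.b₄ • d (z l) := by
  have h1 := op_smul_sum (fun _ => 1) z (fun k => d (zs k)) (z (q := q) l)
  have h2 : hPlus d = ∑ k : Fin N, (1 : ℂ) • (z (q := q) k • d (zs k)) := by simp [hPlus]
  rw [← h2] at h1
  rw [h1]
  simp only [h.dzs_z]
  rw [sum_smul_bimodule (fun _ => 1) z zs _ (fun k => if k = l then (1 : ℂ) else 0) (z l) (d (z l))
    (hPlus d) (hMinus d) 1 t.a₄ t.b₄ t.c₄ t.d₄ t.e₄ t.f₄ (by simp [sum_z_mul_zs]) (z l)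
      (by simp),
    sum_smul_sum_smul _ _ _ _ _ (fun j => (q : ℂ) • (z l * z j))
      (by simpa using fun j => sum_rMatR_z_mul_z hq j l)]
  have h3 : ∑ j, ((q : ℂ) • (z l * z j : Sphere N q)) • d (zs j) =
      (q : ℂ) • ((z l : Sphere N q) • hPlus d) := by
    simp only [hPlus, Finset.smul_sum, smul_assoc, mul_smul]
  rw [h3]
  generalize (z l : Sphere N q) • hPlus d = x
  generalize (z l : Sphere N q) • hMinus d = y
  module

theorem HasBimoduleStructure.hMinus_z (h : HasBimoduleStructure t d) (hq : q ≠ 0) (l : Fin N) :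
    hMinus d <• (z l : Sphere N q) =
      (((q : ℂ) ^ 2)⁻¹ * t.c₁) • ((z l : Sphere N q) • hPlus d)
        + ((q : ℂ)⁻¹ * t.a₁ + ((q : ℂ) ^ 2)⁻¹ * t.e₁) • ((z l : Sphere N q) • hMinus d)
        + (((q : ℂ) ^ 2)⁻¹ * t.b₁) • d (z l) := by
  have h1 := op_smul_sum (fun k => weight q k) zs (fun k => d (z k)) (z (q := q) l)
  rw [← hMinus_eq] at h1
  rw [h1]
  simp only [h.dz_z]
  -- There are no Kronecker terms in `dz_k z_l`, so `δ`, `d'` and `f` are taken to be zero.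
  have h0 := sum_smul_bimodule (fun k => weight q k) zs z
    (fun k => ∑ i, ∑ j, rMatInv q i j k l • (z (q := q) i • d (z j))) (fun _ => 0) (z l) (d (z l))
    (hPlus d) (hMinus d) (((q : ℂ) ^ 2)⁻¹) t.a₁ t.b₁ t.c₁ 0 t.e₁ 0 (sum_weight_smul hq) 0 (by simp)
  simp only [mul_zero, zero_smul, add_zero, smul_zero] at h0
  rw [h0, sum_smul_sum_smul _ _ _ _ _ (fun j => ((q : ℂ)⁻¹ * weight q j) • (z l * zs j))
    fun j => sum_rMatInv_zs_mul_z hq j l]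
  have h3 : ∑ j : Fin N, (((q : ℂ)⁻¹ * weight q j) • (z l * zs j : Sphere N q)) • d (z j) =
      (q : ℂ)⁻¹ • ((z l : Sphere N q) • hMinus d) := by
    simp only [hMinus_eq, Finset.smul_sum, smul_assoc, mul_smul, smul_comm (z l) (weight q _)]
  rw [h3]
  generalize (z l : Sphere N q) • hPlus d = x
  generalize (z l : Sphere N q) • hMinus d = y
  module

theorem HasBimoduleStructure.hPlus_zs (h : HasBimoduleStructure t d) (hq : q ≠ 0) (l : Fin N) :
    hPlus d <• (zs l : Sphere N q) =
      (q * t.a₂ + t.c₂) • ((zs l : Sphere N q) • hPlus d)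
        + t.e₂ • ((zs l : Sphere N q) • hMinus d) + t.b₂ • d (zs l) := by
  have h1 := op_smul_sum (fun _ => 1) z (fun k => d (zs k)) (zs (q := q) l)
  have h2 : hPlus d = ∑ k : Fin N, (1 : ℂ) • (z (q := q) k • d (zs k)) := by simp [hPlus]
  rw [← h2] at h1
  rw [h1]
  simp only [h.dzs_zs]
  have h0 := sum_smul_bimodule (N := N) (q := q) (fun _ => 1) z zs
    (fun k => ∑ i, ∑ j, rMatC q i j k l • (zs (q := q) i • d (zs j))) (fun _ => 0) (zs l) (d (zs l))
    (hPlus d) (hMinus d) 1 t.a₂ t.b₂ t.c₂ 0 t.e₂ 0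
    (by simp [sum_z_mul_zs]) 0 (by simp)
  simp only [mul_zero, zero_smul, add_zero, smul_zero] at h0
  rw [h0, sum_smul_sum_smul _ _ _ _ _ (fun j => (q : ℂ) • (zs l * z j))
    (by simpa using fun j => sum_rMatC_z_mul_zs hq j l)]
  have h3 : ∑ j, ((q : ℂ) • (zs l * z j : Sphere N q)) • d (zs j) =
      (q : ℂ) • ((zs l : Sphere N q) • hPlus d) := by
    simp only [hPlus, Finset.smul_sum, smul_assoc, mul_smul]
  rw [h3]
  generalize (zs l : Sphere N q) • hPlus d = x
  generalize (zs l : Sphere N q) • hMinus d = y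
  module

theorem HasBimoduleStructure.hMinus_zs (h : HasBimoduleStructure t d) (hq : q ≠ 0) (l : Fin N) :
    hMinus d <• (zs l : Sphere N q) =
      (((q : ℂ) ^ 2)⁻¹ * t.c₃ + t.d₃) • ((zs l : Sphere N q) • hPlus d)
        + ((q : ℂ)⁻¹ * t.a₃ + ((q : ℂ) ^ 2)⁻¹ * t.e₃ + t.f₃) • ((zs l : Sphere N q) • hMinus d)
        + (((q : ℂ) ^ 2)⁻¹ * t.b₃) • d (zs l) := by
  have h1 := op_smul_sum (fun k => weight q k) zs (fun k => d (z k)) (zs (q := q) l)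
  rw [← hMinus_eq] at h1
  rw [h1]
  simp only [h.dz_zs]
  -- The weight `q^{-2k}` cancels the factor `q^{2k}` accompanying `δ_{kl}`.
  rw [sum_smul_bimodule (fun k => weight q k) zs z _
      (fun k => if k = l then (q : ℂ) ^ (2 * ((k : ℕ) + 1)) else 0) (zs l) (d (zs l))
      (hPlus d) (hMinus d) (((q : ℂ) ^ 2)⁻¹) t.a₃ t.b₃ t.c₃ t.d₃ t.e₃ t.f₃
      (sum_weight_smul hq) (zs l) (by simp [weight_mul_pow hq]),
    sum_smul_sum_smul _ _ _ _ _ (fun j => ((q : ℂ)⁻¹ * weight q j) • (zs l * zs j))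
      fun j => sum_rMatLInv_zs_mul_zs hq j l]
  have h3 : ∑ j : Fin N, (((q : ℂ)⁻¹ * weight q j) • (zs l * zs j : Sphere N q)) • d (z j) =
      (q : ℂ)⁻¹ • ((zs l : Sphere N q) • hMinus d) := by
    simp only [hMinus_eq, Finset.smul_sum, smul_assoc, mul_smul, smul_comm (zs l) (weight q _)]
  rw [h3]
  generalize (zs l : Sphere N q) • hPlus d = x
  generalize (zs l : Sphere N q) • hMinus d = y
  module

end RightMultiplication

/-! ### Linear independence -/

section Independence

variable {N : ℕ} {q : ℝ} {Γ : Type*} [AddCommGroup Γ] [Module ℂ Γ] [Module (Sphere N q) Γ]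
  [IsScalarTower ℂ (Sphere N q) Γ] {d : Sphere N q →ₗ[ℂ] Γ}

/-- Since `a` has index 1, the term `E da` does not touch the basis vectors of index 2. There the
coefficients are `A x z_2` at `dz*_2` and a nonzero multiple of `B x z*_2` at `dz_2`, with `x z_2`
and `x z*_2` nonzero. Once `A = B = 0`, the coefficient at `da` gives `E = 0`. -/
theorem IsFreelyGenerated.coeffs_eq_zero (h : IsFreelyGenerated d) (hN : 2 ≤ N) (hq : q ≠ 0)
    (hq₁ : q ≠ 1) (hq₂ : q ≠ -1) {a : Fin N ⊕ Fin N} (ha : IsGenOf ⟨0, by omega⟩ a) {A B E : ℂ}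
    (h0 : A • ((gen a : Sphere N q) • hPlus d) + B • ((gen a : Sphere N q) • hMinus d)
      + E • d (gen a) = 0) : A = 0 ∧ B = 0 ∧ E = 0 := by
  classical
  have := nontrivial_sphere hN hq
  let g : Fin N ⊕ Fin N → Sphere N q := Sum.elim
    (fun i => (B * weight q i) • (gen a * zs i)) (fun i => A • (gen a * z i))
  have hsum : ∑ b, (g b + if b = a then E • (1 : Sphere N q) else 0) • d (gen b) = 0 := by
    rw [← h0]
    simp only [add_smul, Finset.sum_add_distrib, ite_smul, zero_smul, Finset.sum_ite_eq',
      Finset.mem_univ, if_true, smul_assoc, one_smul]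
    rw [Fintype.sum_sum_type, add_comm (∑ i, _)]
    congr 2
    · simp only [g, Sum.elim_inr, hPlus, Finset.smul_sum, smul_assoc, mul_smul]
      rfl
    · simp only [g, Sum.elim_inl, hMinus_eq, Finset.smul_sum, smul_assoc, mul_smul,
        smul_comm (gen a) (weight q _)]
      rfl
  have hzero := Fintype.linearIndependent_iff.1 h.linearIndependent _ hsum
  have hA : A = 0 := by
    have h1 := hzero (Sum.inr ⟨1, by omega⟩)
    rw [if_neg (by rcases ha with rfl | rfl <;> simp), add_zero] at h1
    exact (smul_eq_zero.1 h1).resolve_right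
      (gen_mul_gen_ne_zero hN hq hq₁ hq₂ ha (Or.inl rfl))
  have hB : B = 0 := by
    have h1 := hzero (Sum.inl ⟨1, by omega⟩)
    rw [if_neg (by rcases ha with rfl | rfl <;> simp), add_zero] at h1
    have h2 := (smul_eq_zero.1 h1).resolve_right
      (gen_mul_gen_ne_zero hN hq hq₁ hq₂ ha (Or.inr rfl))
    exact (mul_eq_zero.1 h2).resolve_right (weight_ne_zero hq _)
  refine ⟨hA, hB, ?_⟩
  subst hA hB
  simp only [zero_smul, zero_add] at h0
  have h1 := hzero a
  have hg : g a = 0 := by rcases ha with rfl | rfl <;> simp [g]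
  rw [hg, if_pos rfl, zero_add] at h1
  exact (smul_eq_zero.1 h1).resolve_right one_ne_zero

theorem IsFreelyGenerated.invariant_eq_zero (h : IsFreelyGenerated d) (hN : 2 ≤ N) (hq : q ≠ 0)
    (hq₁ : q ≠ 1) (hq₂ : q ≠ -1) {A B : ℂ} (h0 : A • hPlus d + B • hMinus d = 0) :
    A = 0 ∧ B = 0 := by
  have h1 := h.coeffs_eq_zero hN hq hq₁ hq₂ (a := Sum.inl ⟨0, by omega⟩) (Or.inl rfl)
    (A := A) (B := B) (E := 0) (by
      rw [← smul_comm (gen _) A, ← smul_comm (gen _) B, ← smul_add, h0]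
      simp)
  exact ⟨h1.1, h1.2.1⟩

end Independence

/-! ### Quasi-commuting invariant forms -/

/-- The linear equations in `μ`, `λ` and the factors `C` expressing that `μ H₊ + λ H₋`
quasi-commutes with the generators `z_i` with factor `C` and with `z*_i` with factor `C'`. -/
structure IsQuasiPair (q : ℝ) (t : Coeffs) (m l C C' : ℂ) : Prop where
  z_plus : m * (q * t.a₄ + t.c₄ + t.d₄) + l * (((q : ℂ) ^ 2)⁻¹ * t.c₁) = C * m
  z_minus : m * (t.e₄ + t.f₄) + l * ((q : ℂ)⁻¹ * t.a₁ + ((q : ℂ) ^ 2)⁻¹ * t.e₁) = C * l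
  z_d : m * t.b₄ + l * (((q : ℂ) ^ 2)⁻¹ * t.b₁) = 0
  zs_plus : m * (q * t.a₂ + t.c₂) + l * (((q : ℂ) ^ 2)⁻¹ * t.c₃ + t.d₃) = C' * m
  zs_minus : m * t.e₂ + l * ((q : ℂ)⁻¹ * t.a₃ + ((q : ℂ) ^ 2)⁻¹ * t.e₃ + t.f₃) = C' * l
  zs_d : m * t.b₂ + l * (((q : ℂ) ^ 2)⁻¹ * t.b₃) = 0

section LeftModule

variable {N : ℕ} {q : ℝ} {Γ : Type*} [AddCommGroup Γ] [Module ℂ Γ] [Module (Sphere N q) Γ]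
  {d : Sphere N q →ₗ[ℂ] Γ}

theorem mem_invariantForms {η : Γ} :
    η ∈ invariantForms d ↔ ∃ m l : ℂ, m • hPlus d + l • hMinus d = η :=
  Submodule.mem_span_pair

variable [IsScalarTower ℂ (Sphere N q) Γ]

/-- Comparison of coefficients in `η x = C x η` for a generator `x` with index `1`. -/
theorem IsFreelyGenerated.coeffs_eq (h : IsFreelyGenerated d) (hN : 2 ≤ N) (hq : q ≠ 0)
    (hq₁ : q ≠ 1) (hq₂ : q ≠ -1) {a : Fin N ⊕ Fin N} (ha : IsGenOf ⟨0, by omega⟩ a)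
    {A B E C m l : ℂ}
    (h0 : A • ((gen a : Sphere N q) • hPlus d) + B • ((gen a : Sphere N q) • hMinus d)
      + E • d (gen a) = C • ((gen a : Sphere N q) • (m • hPlus d + l • hMinus d))) :
    A = C * m ∧ B = C * l ∧ E = 0 := by
  have h1 := h.coeffs_eq_zero hN hq hq₁ hq₂ ha (A := A - C * m) (B := B - C * l) (E := E) (by
    rw [← sub_eq_zero, smul_add (gen a), smul_comm (gen a) m, smul_comm (gen a) l] at h0
    rw [← h0]
    generalize (gen a : Sphere N q) • hPlus d = x
    generalize (gen a : Sphere N q) • hMinus d = y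
    module)
  exact ⟨sub_eq_zero.1 h1.1, sub_eq_zero.1 h1.2.1, h1.2.2⟩

end LeftModule

section QuasiCommuting

variable {N : ℕ} {q : ℝ} {Γ : Type*} [AddCommGroup Γ] [Module ℂ Γ]
  [Module (Sphere N q) Γ] [Module (Sphere N q)ᵐᵒᵖ Γ]
  [SMulCommClass (Sphere N q) (Sphere N q)ᵐᵒᵖ Γ]
  [IsScalarTower ℂ (Sphere N q) Γ] [IsScalarTower ℂ (Sphere N q)ᵐᵒᵖ Γ]
  {t : Coeffs} {d : Sphere N q →ₗ[ℂ] Γ}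

theorem HasBimoduleStructure.op_z_smul (h : HasBimoduleStructure t d) (hq : q ≠ 0) (i : Fin N)
    (m l : ℂ) :
    (m • hPlus d + l • hMinus d) <• (z i : Sphere N q) =
      (m * (q * t.a₄ + t.c₄ + t.d₄) + l * (((q : ℂ) ^ 2)⁻¹ * t.c₁)) •
          ((z i : Sphere N q) • hPlus d)
        + (m * (t.e₄ + t.f₄) + l * ((q : ℂ)⁻¹ * t.a₁ + ((q : ℂ) ^ 2)⁻¹ * t.e₁)) •
          ((z i : Sphere N q) • hMinus d)
        + (m * t.b₄ + l * (((q : ℂ) ^ 2)⁻¹ * t.b₁)) • d (z i) := by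
  rw [smul_add, smul_comm _ m, smul_comm _ l, h.hPlus_z hq, h.hMinus_z hq]
  generalize (z i : Sphere N q) • hPlus d = x
  generalize (z i : Sphere N q) • hMinus d = y
  module

theorem HasBimoduleStructure.op_zs_smul (h : HasBimoduleStructure t d) (hq : q ≠ 0) (i : Fin N)
    (m l : ℂ) :
    (m • hPlus d + l • hMinus d) <• (zs i : Sphere N q) =
      (m * (q * t.a₂ + t.c₂) + l * (((q : ℂ) ^ 2)⁻¹ * t.c₃ + t.d₃)) •
          ((zs i : Sphere N q) • hPlus d)
        + (m * t.e₂ + l * ((q : ℂ)⁻¹ * t.a₃ + ((q : ℂ) ^ 2)⁻¹ * t.e₃ + t.f₃)) •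
          ((zs i : Sphere N q) • hMinus d)
        + (m * t.b₂ + l * (((q : ℂ) ^ 2)⁻¹ * t.b₃)) • d (zs i) := by
  rw [smul_add, smul_comm _ m, smul_comm _ l, h.hPlus_zs hq, h.hMinus_zs hq]
  generalize (zs i : Sphere N q) • hPlus d = x
  generalize (zs i : Sphere N q) • hMinus d = y
  module

theorem IsQuasiPair.op_z_smul {m l C C' : ℂ} (hp : IsQuasiPair q t m l C C')
    (h : HasBimoduleStructure t d) (hq : q ≠ 0) (i : Fin N) :
    (m • hPlus d + l • hMinus d) <• (z i : Sphere N q) =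
      C • ((z i : Sphere N q) • (m • hPlus d + l • hMinus d)) := by
  rw [h.op_z_smul hq, hp.z_plus, hp.z_minus, hp.z_d, smul_add (z i), smul_comm (z i) m,
    smul_comm (z i) l]
  generalize (z i : Sphere N q) • hPlus d = x
  generalize (z i : Sphere N q) • hMinus d = y
  module

theorem IsQuasiPair.op_zs_smul {m l C C' : ℂ} (hp : IsQuasiPair q t m l C C')
    (h : HasBimoduleStructure t d) (hq : q ≠ 0) (i : Fin N) :
    (m • hPlus d + l • hMinus d) <• (zs i : Sphere N q) =
      C' • ((zs i : Sphere N q) • (m • hPlus d + l • hMinus d)) := by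
  rw [h.op_zs_smul hq, hp.zs_plus, hp.zs_minus, hp.zs_d, smul_add (zs i), smul_comm (zs i) m,
    smul_comm (zs i) l]
  generalize (zs i : Sphere N q) • hPlus d = x
  generalize (zs i : Sphere N q) • hMinus d = y
  module

/-- The generators of index 1 already yield all the equations. Conversely, the scalars are
independent of the index, so one pair `C`, `C'` serves every generator, although the definition
allows `C` to vary. -/
theorem IsCalculus.quasiCommutesGenerators_iff (h : IsCalculus t d) (hN : 2 ≤ N) (hq : q ≠ 0)
    (hq₁ : q ≠ 1) (hq₂ : q ≠ -1) (m l : ℂ) :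
    QuasiCommutesGenerators N q (m • hPlus d + l • hMinus d) ↔
      ∃ C C', IsQuasiPair q t m l C C' := by
  constructor
  · intro hqc
    obtain ⟨C, hC⟩ := hqc (Sum.inl ⟨0, by omega⟩)
    obtain ⟨C', hC'⟩ := hqc (Sum.inr ⟨0, by omega⟩)
    obtain ⟨h1, h2, h3⟩ := h.isFreelyGenerated.coeffs_eq hN hq hq₁ hq₂ (Or.inl rfl)
      ((h.hasBimoduleStructure.op_z_smul hq _ m l).symm.trans hC)
    obtain ⟨h1', h2', h3'⟩ := h.isFreelyGenerated.coeffs_eq hN hq hq₁ hq₂ (Or.inr rfl)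
      ((h.hasBimoduleStructure.op_zs_smul hq _ m l).symm.trans hC')
    exact ⟨C, C', h1, h2, h3, h1', h2', h3'⟩
  · rintro ⟨C, C', hp⟩ (i | i)
    · exact ⟨C, hp.op_z_smul h.hasBimoduleStructure hq i⟩
    · exact ⟨C', hp.op_zs_smul h.hasBimoduleStructure hq i⟩

/-! ### From generators to homogeneous elements -/

theorem op_mul_smul_of_eq {η : Γ} {x y : Sphere N q} {A B : ℂ} (hx : η <• x = A • (x • η))
    (hy : η <• y = B • (y • η)) : η <• (x * y) = (A * B) • ((x * y) • η) := by
  rw [MulOpposite.op_mul, mul_smul, hx, smul_comm (MulOpposite.op y) A,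
    ← smul_comm x (MulOpposite.op y), hy, smul_comm x B, smul_smul, smul_smul]

/-- A form that quasi-commutes with the `z_i` and with the `z*_i`, with factors `C` and `C'`
independent of `i`, quasi-commutes with all homogeneous elements. -/
theorem quasiCommutesHomogeneous_of_forall {η : Γ} {C C' : ℂ}
    (hz : ∀ i : Fin N, η <• (z i : Sphere N q) = C • ((z i : Sphere N q) • η))
    (hzs : ∀ i : Fin N, η <• (zs i : Sphere N q) = C' • ((zs i : Sphere N q) • η)) :
    QuasiCommutesHomogeneous N q η := by
  by_cases hη : η = 0
  · subst hη
    intro n x _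
    exact ⟨0, by simp⟩
  -- Moving `η` past `∑ z_i z*_i = 1` multiplies it by `C C'`.
  have hCC : C * C' = 1 := by
    have h1 : η <• (∑ i : Fin N, z i * zs i : Sphere N q) =
        (C * C') • ((∑ i : Fin N, z i * zs i : Sphere N q) • η) := by
      simp only [Finset.op_sum, Finset.sum_smul, Finset.smul_sum,
        op_mul_smul_of_eq (hz _) (hzs _)]
    rw [sum_z_mul_zs, MulOpposite.op_one, one_smul, one_smul] at h1
    have h2 : (C * C' - 1) • η = 0 := by rw [sub_smul, one_smul, ← h1, sub_self]
    exact sub_eq_zero.1 ((smul_eq_zero.1 h2).resolve_right hη)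
  have hC : C ≠ 0 := left_ne_zero_of_mul_eq_one hCC
  have hC' : C' = C⁻¹ := eq_inv_of_mul_eq_one_right hCC
  have hgen (a : Fin N ⊕ Fin N) :
      η <• (gen a : Sphere N q) = C ^ genDegree a • ((gen a : Sphere N q) • η) := by
    rcases a with i | i
    · simpa [genDegree, z] using hz i
    · simpa [genDegree, hC', zs] using hzs i
  intro n x hx
  -- The factor depends on the degree alone, so the identity passes from monomials to their linear
  -- combinations.
  refine ⟨C ^ n, ?_⟩
  induction hx using Submodule.span_induction with
  | mem x hx =>
    obtain ⟨w, rfl, rfl⟩ := hx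
    induction w with
    | nil => simp
    | cons a w ih =>
      simp only [List.map_cons, List.prod_cons, List.sum_cons, zpow_add₀ hC]
      exact op_mul_smul_of_eq (hgen a) ih
  | zero => simp
  | add x y _ _ hx hy => rw [MulOpposite.op_add, add_smul, hx, hy, add_smul, smul_add]
  | smul c x _ hx => rw [MulOpposite.op_smul, smul_assoc, hx, smul_assoc, smul_comm c]

theorem IsCalculus.quasiCommutesHomogeneous (h : IsCalculus t d) (hN : 2 ≤ N) (hq : q ≠ 0)
    (hq₁ : q ≠ 1) (hq₂ : q ≠ -1) (η : Γ) (hη : η ∈ invariantForms d)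
    (hqc : QuasiCommutesGenerators N q η) : QuasiCommutesHomogeneous N q η := by
  obtain ⟨m, l, rfl⟩ := mem_invariantForms.1 hη
  obtain ⟨C, C', hp⟩ := (h.quasiCommutesGenerators_iff hN hq hq₁ hq₂ m l).1 hqc
  exact quasiCommutesHomogeneous_of_forall (hp.op_z_smul h.hasBimoduleStructure hq)
    (hp.op_zs_smul h.hasBimoduleStructure hq)

end QuasiCommuting

theorem IsQuasiPair.smul {q : ℝ} {t : Coeffs} {m l C C' : ℂ} (h : IsQuasiPair q t m l C C')
    (c : ℂ) : IsQuasiPair q t (c * m) (c * l) C C' where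
  z_plus := by linear_combination c * h.z_plus
  z_minus := by linear_combination c * h.z_minus
  z_d := by linear_combination c * h.z_d
  zs_plus := by linear_combination c * h.zs_plus
  zs_minus := by linear_combination c * h.zs_minus
  zs_d := by linear_combination c * h.zs_d

/-! ### Lines of quasi-commuting forms -/

section Lines

variable {N : ℕ} {q : ℝ} {Γ : Type*} [AddCommGroup Γ] [Module ℂ Γ]
  [Module (Sphere N q) Γ] [IsScalarTower ℂ (Sphere N q) Γ] {d : Sphere N q →ₗ[ℂ] Γ}

theorem IsFreelyGenerated.invariant_ext (h : IsFreelyGenerated d) (hN : 2 ≤ N) (hq : q ≠ 0)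
    (hq₁ : q ≠ 1) (hq₂ : q ≠ -1) {A B A' B' : ℂ}
    (h0 : A • hPlus d + B • hMinus d = A' • hPlus d + B' • hMinus d) : A = A' ∧ B = B' := by
  have h1 := h.invariant_eq_zero hN hq hq₁ hq₂ (A := A - A') (B := B - B') (by
    rw [← sub_eq_zero] at h0
    rw [← h0]
    module)
  exact ⟨sub_eq_zero.1 h1.1, sub_eq_zero.1 h1.2⟩

theorem IsFreelyGenerated.span_hPlus_add_injective (h : IsFreelyGenerated d) (hN : 2 ≤ N)
    (hq : q ≠ 0) (hq₁ : q ≠ 1) (hq₂ : q ≠ -1) {l l' : ℂ}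
    (h0 : Submodule.span ℂ {hPlus d + l • hMinus d} =
      Submodule.span ℂ {hPlus d + l' • hMinus d}) : l = l' := by
  have h1 : hPlus d + l • hMinus d ∈ Submodule.span ℂ {hPlus d + l' • hMinus d} := by
    rw [← h0]
    exact Submodule.mem_span_singleton_self _
  obtain ⟨c, hc⟩ := Submodule.mem_span_singleton.1 h1
  obtain ⟨h2, h3⟩ := h.invariant_ext hN hq hq₁ hq₂ (A := c) (B := c * l') (A' := 1) (B' := l) (by
    rw [one_smul, ← hc]
    module)
  rw [← h3, h2, one_mul]

theorem IsFreelyGenerated.span_hPlus_add_ne (h : IsFreelyGenerated d) (hN : 2 ≤ N)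
    (hq : q ≠ 0) (hq₁ : q ≠ 1) (hq₂ : q ≠ -1) (l : ℂ) :
    Submodule.span ℂ {hPlus d + l • hMinus d} ≠ Submodule.span ℂ {hMinus d} := by
  intro h0
  have h1 : hPlus d + l • hMinus d ∈ Submodule.span ℂ {hMinus d} := by
    rw [← h0]
    exact Submodule.mem_span_singleton_self _
  obtain ⟨c, hc⟩ := Submodule.mem_span_singleton.1 h1
  obtain ⟨h2, -⟩ := h.invariant_ext hN hq hq₁ hq₂ (A := 0) (B := c) (A' := 1) (B' := l) (by
    rw [one_smul, ← hc]
    module)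
  exact zero_ne_one h2

variable [Module (Sphere N q)ᵐᵒᵖ Γ] [SMulCommClass (Sphere N q) (Sphere N q)ᵐᵒᵖ Γ]
  [IsScalarTower ℂ (Sphere N q)ᵐᵒᵖ Γ] {t : Coeffs}

/-- Affine chart on the projective line of ratios `μ : λ`: either `μ` is normalised to 1, or the
line is the point at infinity spanned by `H₋`. -/
theorem IsCalculus.mem_quasiLines_iff (h : IsCalculus t d) (hN : 2 ≤ N) (hq : q ≠ 0)
    (hq₁ : q ≠ 1) (hq₂ : q ≠ -1) (L : Submodule ℂ Γ) :
    L ∈ quasiLines d ↔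
      (∃ l, (∃ C C', IsQuasiPair q t 1 l C C') ∧
        L = Submodule.span ℂ {hPlus d + l • hMinus d}) ∨
      ((∃ C C', IsQuasiPair q t 0 1 C C') ∧ L = Submodule.span ℂ {hMinus d}) := by
  have hiff := h.quasiCommutesGenerators_iff hN hq hq₁ hq₂
  constructor
  · rintro ⟨η, hη, hη0, hqc, rfl⟩
    obtain ⟨m, l, rfl⟩ := mem_invariantForms.1 hη
    obtain ⟨C, C', hp⟩ := (hiff m l).1 hqc
    by_cases hm : m = 0
    · subst hm
      have hl : l ≠ 0 := by
        rintro rfl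
        simp at hη0
      right
      refine ⟨⟨C, C', ?_⟩, ?_⟩
      · simpa [hl] using hp.smul l⁻¹
      · rw [zero_smul, zero_add, Submodule.span_singleton_smul_eq (IsUnit.mk0 l hl)]
    · left
      refine ⟨m⁻¹ * l, ⟨C, C', ?_⟩, ?_⟩
      · simpa [hm] using hp.smul m⁻¹
      · rw [← Submodule.span_singleton_smul_eq (IsUnit.mk0 m hm) (hPlus d + _), smul_add, smul_smul,
          mul_inv_cancel_left₀ hm]
  · rintro (⟨l, hp, rfl⟩ | ⟨hp, rfl⟩)
    · refine ⟨_, mem_invariantForms.2 ⟨1, l, by rw [one_smul]⟩, ?_, ?_, rfl⟩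
      · intro h0
        have := h.isFreelyGenerated.invariant_eq_zero hN hq hq₁ hq₂ (A := 1) (B := l)
          (by rw [one_smul, h0])
        exact one_ne_zero this.1
      · have := (hiff 1 l).2 hp
        rwa [one_smul] at this
    · refine ⟨_, mem_invariantForms.2 ⟨0, 1, by rw [one_smul, zero_smul, zero_add]⟩, ?_, ?_, rfl⟩
      · intro h0
        have := h.isFreelyGenerated.invariant_eq_zero hN hq hq₁ hq₂ (A := 0) (B := 1)
          (by rw [one_smul, h0, zero_smul, add_zero])
        exact one_ne_zero this.2
      · have := (hiff 0 1).2 hp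
        rwa [one_smul, zero_smul, zero_add] at this

end Lines

/-! ### The equations for the four families -/

section Families

variable {N : ℕ} {q : ℝ}

theorem ofReal_sPlus : (sPlus N q : ℂ) = sPlus' N q + 1 := by
  unfold sPlus'
  push_cast
  ring

/-- The geometric sum with one more term is split off at either end. This removes `q^{2N}`, so the
equations of the families become rational identities in `q`, `s'` and the parameters. -/
theorem pow_two_mul_eq : (q : ℂ) ^ (2 * N) = q ^ 2 * (sPlus' N q + 1) - sPlus' N q := by
  have h : q ^ (2 * N) = q ^ 2 * (sPlus' N q + 1) - sPlus' N q := by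
    have h1 := Finset.sum_range_succ (fun i => q ^ (2 * i)) N
    rw [Finset.sum_range_succ'] at h1
    unfold sPlus' sPlus
    simp only [mul_add, pow_add, ← Finset.sum_mul, mul_one, mul_zero, pow_zero] at h1 ⊢
    linarith
  exact_mod_cast congrArg ((↑) : ℝ → ℂ) h

theorem zpow_two_mul_sub_two_eq (hq : q ≠ 0) :
    (q : ℂ) ^ (2 * (N : ℤ) - 2) = ((q : ℂ) ^ 2)⁻¹ * (q ^ 2 * (sPlus' N q + 1) - sPlus' N q) := by
  have hq' : (q : ℂ) ≠ 0 := by exact_mod_cast hq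
  rw [zpow_sub₀ hq', ← pow_two_mul_eq, div_eq_inv_mul, ← zpow_natCast (q : ℂ) (2 * N)]
  push_cast
  rfl

/-- The equations coming from the terms `dz_i` when `a_i`, `b_i` are as in `Γ_{ατ}`. -/
theorem eq_inv_of_isQuasiPair (hq : q ≠ 0) {α : ℝ} (hα : α ≠ 0) (hα' : α ≠ (q ^ 2)⁻¹)
    {t : Coeffs} (h1 : t.b₁ = q ^ 2 * α - 1) (h4 : t.b₄ = ((q : ℂ) ^ 2)⁻¹ * (α : ℂ)⁻¹ - 1)
    {m l C C' : ℂ} (h : IsQuasiPair q t m l C C') : l = m * (α : ℂ)⁻¹ := by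
  have hq' : (q : ℂ) ≠ 0 := by exact_mod_cast hq
  have hα0 : (α : ℂ) ≠ 0 := by exact_mod_cast hα
  have hne : (q : ℂ) ^ 2 * α - 1 ≠ 0 := by
    intro h0
    have h0' : q ^ 2 * α - 1 = 0 := by exact_mod_cast h0
    exact hα' (eq_inv_of_mul_eq_one_right (by linarith))
  have h0 := h.z_d
  rw [h1, h4] at h0
  apply mul_left_cancel₀ hne
  -- Multiplied by `q²`, the `dz` equation factors as `(q²α - 1)(l - m α⁻¹) = 0`.
  linear_combination (norm := (field_simp; ring)) (q : ℂ) ^ 2 * h0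

theorem gamma_isQuasiPair (hq : q ≠ 0) {α : ℝ} (hα : α ≠ 0) (τ : ℝ) :
    IsQuasiPair q (gammaCoeffs N q α τ) 1 (α : ℂ)⁻¹ α (α : ℂ)⁻¹ := by
  have hq' : (q : ℂ) ≠ 0 := by exact_mod_cast hq
  have hα0 : (α : ℂ) ≠ 0 := by exact_mod_cast hα
  constructor <;> simp only [gammaCoeffs, ofReal_sPlus, pow_two_mul_eq] <;> field_simp <;> ring

/-- Here `q a₄ + c₄ + d₄ = 0`, so the first equation reads off `C` from `c₁` alone; `C'` is its
inverse. -/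
theorem gammaPrime_isQuasiPair (hq : q ≠ 0) {α ω : ℝ} (hα : α ≠ 0) (hω : ω ≠ 0) :
    IsQuasiPair q (gammaPrimeCoeffs q α ω) 1 (α : ℂ)⁻¹ (((q : ℂ) ^ 2)⁻¹ * ω * (α : ℂ)⁻¹)
      (q ^ 2 * α * (ω : ℂ)⁻¹) := by
  have hq' : (q : ℂ) ≠ 0 := by exact_mod_cast hq
  have hα0 : (α : ℂ) ≠ 0 := by exact_mod_cast hα
  have hω0 : (ω : ℂ) ≠ 0 := by exact_mod_cast hω
  constructor <;> simp only [gammaPrimeCoeffs] <;> field_simp <;> ring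

/-- The `H₊` equations determine `C = q^{-2} ω l` and `C' = ψ - q^{-2} l`. Substituted into the two
`H₋` equations, both give the stated quadratic up to a nonzero factor. -/
theorem gammaSecond_isQuasiPair_iff (hq : q ≠ 0) {ω : ℝ} (hω : ω ≠ 0) (ψ : ℝ) (l : ℂ) :
    (∃ C C', IsQuasiPair q (gammaSecondCoeffs q ω ψ) 1 l C C') ↔
      ((q : ℂ) ^ 4)⁻¹ * ω * l ^ 2 - ((q : ℂ) ^ 2)⁻¹ * ω * ψ * l + 1 = 0 := by
  have hq' : (q : ℂ) ≠ 0 := by exact_mod_cast hq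
  have hω0 : (ω : ℂ) ≠ 0 := by exact_mod_cast hω
  constructor
  · rintro ⟨C, C', h⟩
    have h1 := h.z_plus
    have h2 := h.z_minus
    simp only [gammaSecondCoeffs] at h1 h2
    field_simp at h1 h2 ⊢
    linear_combination l * h1 - h2
  · intro h
    refine ⟨((q : ℂ) ^ 2)⁻¹ * ω * l, ψ - ((q : ℂ) ^ 2)⁻¹ * l, ?_⟩
    constructor <;> simp only [gammaSecondCoeffs] <;> try (field_simp; ring1)
    · linear_combination (norm := (field_simp; ring)) -(q : ℂ) ^ 2 * h
    · linear_combination (norm := (field_simp; ring)) (q : ℂ) ^ 2 * (ω : ℂ)⁻¹ * h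

theorem gammaSecond_not_isQuasiPair (hq : q ≠ 0) {ω : ℝ} (hω : ω ≠ 0) (ψ : ℝ) (C C' : ℂ) :
    ¬ IsQuasiPair q (gammaSecondCoeffs q ω ψ) 0 1 C C' := by
  have hq' : (q : ℂ) ≠ 0 := by exact_mod_cast hq
  have hω0 : (ω : ℂ) ≠ 0 := by exact_mod_cast hω
  intro h
  have h1 := h.z_plus
  simp [gammaSecondCoeffs, hq', hω0] at h1

/-- Eliminating `C` gives, up to a nonzero factor, the product of the two linear polynomials in `l`;
eliminating `C'` gives the same product. -/
theorem gammaThird_isQuasiPair_iff (hq : q ≠ 0) {ϱ τ : ℝ} (hϱ : ϱ ≠ 0) (hτ : τ ≠ 0) (l : ℂ) :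
    (∃ C C', IsQuasiPair q (gammaThirdCoeffs N q ϱ τ) 1 l C C') ↔
      l = (q : ℂ) ^ 2 * τ / ϱ ∨
        (sPlus' N q * ϱ - 1) * l = (q : ℂ) ^ 2 * (sPlus' N q * τ - (q : ℂ) ^ 2) := by
  have hq' : (q : ℂ) ≠ 0 := by exact_mod_cast hq
  have hϱ0 : (ϱ : ℂ) ≠ 0 := by exact_mod_cast hϱ
  have hτ0 : (τ : ℂ) ≠ 0 := by exact_mod_cast hτ
  rw [← sub_eq_zero, ← sub_eq_zero (a := _ * l), ← mul_eq_zero]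
  constructor
  · rintro ⟨C, C', h⟩
    have h1 := h.z_plus
    have h2 := h.z_minus
    simp only [gammaThirdCoeffs, ofReal_sPlus, pow_two_mul_eq, zpow_two_mul_sub_two_eq hq] at h1 h2
    linear_combination (norm := (field_simp; ring))
      -((q : ℂ) ^ 4 * (τ / ϱ)) * (l * h1 - h2)
  · intro h
    -- With `m = 1` the witnesses are the left-hand sides of the two `H₊` equations, which then hold
    -- trivially.
    refine ⟨1 * (q * (gammaThirdCoeffs N q ϱ τ).a₄ + (gammaThirdCoeffs N q ϱ τ).c₄ +
      (gammaThirdCoeffs N q ϱ τ).d₄) + l * (((q : ℂ) ^ 2)⁻¹ * (gammaThirdCoeffs N q ϱ τ).c₁),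
      1 * (q * (gammaThirdCoeffs N q ϱ τ).a₂ + (gammaThirdCoeffs N q ϱ τ).c₂) +
      l * (((q : ℂ) ^ 2)⁻¹ * (gammaThirdCoeffs N q ϱ τ).c₃ + (gammaThirdCoeffs N q ϱ τ).d₃),
      (mul_one _).symm, ?_, ?_, (mul_one _).symm, ?_, ?_⟩ <;>
    simp only [gammaThirdCoeffs, ofReal_sPlus, pow_two_mul_eq, zpow_two_mul_sub_two_eq hq]
    · linear_combination (norm := (field_simp; ring)) ((q : ℂ) ^ 4)⁻¹ * (ϱ / τ) * h
    · ring
    · linear_combination (norm := (field_simp; ring)) -((q : ℂ) ^ 2)⁻¹ * h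
    · ring

theorem gammaThird_isQuasiPair_zero_one_iff (hq : q ≠ 0) {ϱ τ : ℝ} (hϱ : ϱ ≠ 0) (hτ : τ ≠ 0) :
    (∃ C C', IsQuasiPair q (gammaThirdCoeffs N q ϱ τ) 0 1 C C') ↔ sPlus' N q * ϱ = 1 := by
  have hq' : (q : ℂ) ≠ 0 := by exact_mod_cast hq
  have hϱ0 : (ϱ : ℂ) ≠ 0 := by exact_mod_cast hϱ
  have hτ0 : (τ : ℂ) ≠ 0 := by exact_mod_cast hτ
  have hiff : sPlus' N q * ϱ = 1 ↔ (sPlus' N q * ϱ : ℂ) = 1 := by norm_cast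
  rw [hiff]
  constructor
  · rintro ⟨C, C', h⟩
    have h1 := h.z_plus
    simp only [gammaThirdCoeffs] at h1
    have h2 : (sPlus' N q * ϱ - 1 : ℂ) = 0 := by
      linear_combination (norm := (field_simp; ring)) -((q : ℂ) ^ 4 * (τ / ϱ)) * h1
    exact sub_eq_zero.1 h2
  · intro h
    refine ⟨_, _, ?_, (mul_one _).symm, ?_, ?_, (mul_one _).symm, ?_⟩ <;>
      simp only [gammaThirdCoeffs, ofReal_sPlus, eq_inv_of_mul_eq_one_left h] <;> field_simp <;>
      ring

/-- The terms mixing `m` and `l` are multiples of `s'ϱ - 1` or `s'τ - q²`, and both vanish here.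
What remains is scalar: `q^{-2}` for the `z_i` and `q²` for the `z*_i`. -/
theorem gammaThird_isQuasiPair_of_eq (hq : q ≠ 0) {ϱ τ : ℝ} (hϱ : ϱ ≠ 0) (h1 : ϱ = (q ^ 2)⁻¹ * τ)
    (h2 : sPlus' N q * ϱ = 1) (m l : ℂ) :
    IsQuasiPair q (gammaThirdCoeffs N q ϱ τ) m l ((q : ℂ) ^ 2)⁻¹ ((q : ℂ) ^ 2) := by
  have hq' : (q : ℂ) ≠ 0 := by exact_mod_cast hq
  have hϱ0 : (ϱ : ℂ) ≠ 0 := by exact_mod_cast hϱ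
  have h2' : (sPlus' N q * ϱ : ℂ) = 1 := by exact_mod_cast h2
  have hτ : τ = q ^ 2 * ϱ := by
    rw [h1]
    field_simp
  subst hτ
  constructor <;>
    simp only [gammaThirdCoeffs, ofReal_sPlus, pow_two_mul_eq, zpow_two_mul_sub_two_eq hq,
      Complex.ofReal_mul, Complex.ofReal_pow, eq_inv_of_mul_eq_one_left h2'] <;>
    field_simp <;> ring

end Families

/-! ### The quasi-commuting forms of the four families -/

section Classification

variable {N : ℕ} {q : ℝ} {Γ : Type*} [AddCommGroup Γ] [Module ℂ Γ]
  [Module (Sphere N q) Γ] [Module (Sphere N q)ᵐᵒᵖ Γ]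
  [SMulCommClass (Sphere N q) (Sphere N q)ᵐᵒᵖ Γ]
  [IsScalarTower ℂ (Sphere N q) Γ] [IsScalarTower ℂ (Sphere N q)ᵐᵒᵖ Γ]
  {d : Sphere N q →ₗ[ℂ] Γ}

theorem IsCalculus.quasiLines_eq_singleton {t : Coeffs} (h : IsCalculus t d) (hN : 2 ≤ N)
    (hq : q ≠ 0) (hq₁ : q ≠ 1) (hq₂ : q ≠ -1) {α : ℝ} (hα : α ≠ 0) (hα' : α ≠ (q ^ 2)⁻¹)
    (h1 : t.b₁ = q ^ 2 * α - 1) (h4 : t.b₄ = ((q : ℂ) ^ 2)⁻¹ * (α : ℂ)⁻¹ - 1) {C C' : ℂ}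
    (hp : IsQuasiPair q t 1 (α : ℂ)⁻¹ C C') :
    quasiLines d = {Submodule.span ℂ {hPlus d + (α : ℂ)⁻¹ • hMinus d}} := by
  ext L
  rw [h.mem_quasiLines_iff hN hq hq₁ hq₂, Set.mem_singleton_iff]
  constructor
  · rintro (⟨l, ⟨C, C', hl⟩, rfl⟩ | ⟨⟨C, C', hl⟩, rfl⟩)
    · rw [eq_inv_of_isQuasiPair hq hα hα' h1 h4 hl, one_mul]
    · have := eq_inv_of_isQuasiPair hq hα hα' h1 h4 hl
      simp at this
  · rintro rfl
    exact Or.inl ⟨_, ⟨C, C', hp⟩, rfl⟩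

theorem quasiLines_gammaSecond {ω ψ : ℝ} (h : IsCalculus (gammaSecondCoeffs q ω ψ) d)
    (hN : 2 ≤ N) (hq : q ≠ 0) (hq₁ : q ≠ 1) (hq₂ : q ≠ -1) (hω : ω ≠ 0) :
    quasiLines d =
      {L | ∃ l : ℂ, ((q : ℂ) ^ 4)⁻¹ * ω * l ^ 2 - ((q : ℂ) ^ 2)⁻¹ * ω * ψ * l + 1 = 0 ∧
        L = Submodule.span ℂ {hPlus d + l • hMinus d}} := by
  ext L
  rw [h.mem_quasiLines_iff hN hq hq₁ hq₂]
  simp only [gammaSecond_isQuasiPair_iff hq hω, gammaSecond_not_isQuasiPair hq hω, exists_false,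
    false_and, or_false, Set.mem_ofPred_eq]

/-- The roots of the quadratic equation for the forms in `Γ''_{ωψ}`. -/
theorem exists_roots (hq : q ≠ 0) {ω : ℝ} (hω : ω ≠ 0) (ψ : ℝ) :
    ∃ l₁ l₂ : ℂ, (l₁ = l₂ ↔ ω * ψ ^ 2 = 4) ∧ ∀ l : ℂ,
      ((q : ℂ) ^ 4)⁻¹ * ω * l ^ 2 - ((q : ℂ) ^ 2)⁻¹ * ω * ψ * l + 1 = 0 ↔ l = l₁ ∨ l = l₂ := by
  have hq' : (q : ℂ) ≠ 0 := by exact_mod_cast hq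
  have hω0 : (ω : ℂ) ≠ 0 := by exact_mod_cast hω
  -- `r` is a complex square root of the rescaled discriminant, which may be negative; the roots
  -- coincide exactly when `r = 0`.
  obtain ⟨r, hr⟩ := IsAlgClosed.exists_pow_nat_eq ((ω : ℂ) * (ω * ψ ^ 2 - 4)) two_pos
  refine ⟨q ^ 2 * (ω * ψ + r) / (2 * ω), q ^ 2 * (ω * ψ - r) / (2 * ω), ?_, fun l => ?_⟩
  · have h1 : (q : ℂ) ^ 2 * (ω * ψ + r) / (2 * ω) = q ^ 2 * (ω * ψ - r) / (2 * ω) ↔ r = 0 := by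
      constructor
      · intro h
        field_simp at h
        linear_combination h / 2
      · rintro rfl
        ring
    have h2 : ω * ψ ^ 2 = 4 ↔ (ω : ℂ) * ψ ^ 2 - 4 = 0 := by
      rw [sub_eq_zero]
      norm_cast
    rw [h1, h2, ← sq_eq_zero_iff, hr, mul_eq_zero, or_iff_right hω0]
  · rw [← sub_eq_zero (b := _ / _), ← sub_eq_zero (a := l) (b := q ^ 2 * (ω * ψ - r) / (2 * ω)),
      ← mul_eq_zero]
    constructor <;> intro h
    · linear_combination (norm := (field_simp; ring))
        ((q : ℂ) ^ 4 / ω) * h - (q : ℂ) ^ 4 / (4 * ω ^ 2) * hr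
    · linear_combination (norm := (field_simp; ring))
        (ω / (q : ℂ) ^ 4) * h + 1 / (4 * ω : ℂ) * hr

theorem ncard_quasiLines_gammaSecond {ω ψ : ℝ} (h : IsCalculus (gammaSecondCoeffs q ω ψ) d)
    (hN : 2 ≤ N) (hq : q ≠ 0) (hq₁ : q ≠ 1) (hq₂ : q ≠ -1) (hω : ω ≠ 0) :
    (ω * ψ ^ 2 ≠ 4 → (quasiLines d).ncard = 2) ∧ (ω * ψ ^ 2 = 4 → (quasiLines d).ncard = 1) := by
  obtain ⟨l₁, l₂, hl, hroots⟩ := exists_roots hq hω ψ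
  have heq : quasiLines d = {Submodule.span ℂ {hPlus d + l₁ • hMinus d},
      Submodule.span ℂ {hPlus d + l₂ • hMinus d}} := by
    rw [quasiLines_gammaSecond h hN hq hq₁ hq₂ hω]
    ext L
    simp only [hroots, or_and_right, exists_or, exists_eq_left, Set.mem_ofPred_eq,
      Set.mem_insert_iff, Set.mem_singleton_iff]
  rw [heq]
  constructor
  · intro hne
    exact Set.ncard_pair fun h0 =>
      hne (hl.1 (h.isFreelyGenerated.span_hPlus_add_injective hN hq hq₁ hq₂ h0))
  · intro h0
    rw [hl.2 h0, Set.pair_eq_singleton, Set.ncard_singleton]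

/-- The second linear factor degenerates to the constant `q²(q² - τ/ϱ) ≠ 0`: that root has moved to
infinity, where `H₋` takes its place. -/
theorem quasiLines_gammaThird_of_eq_one {ϱ τ : ℝ} (h : IsCalculus (gammaThirdCoeffs N q ϱ τ) d)
    (hN : 2 ≤ N) (hq : q ≠ 0) (hq₁ : q ≠ 1) (hq₂ : q ≠ -1) (hϱ : ϱ ≠ 0) (hτ : τ ≠ 0)
    (hne : τ / ϱ ≠ q ^ 2) (h1 : sPlus' N q * ϱ = 1) :
    quasiLines d = {Submodule.span ℂ {hPlus d + ((q : ℂ) ^ 2 * τ / ϱ) • hMinus d},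
      Submodule.span ℂ {hMinus d}} := by
  have hq' : (q : ℂ) ≠ 0 := by exact_mod_cast hq
  have h1' : (sPlus' N q * ϱ : ℂ) = 1 := by exact_mod_cast h1
  have hne' : (sPlus' N q * τ - (q : ℂ) ^ 2) ≠ 0 := by
    rw [eq_inv_of_mul_eq_one_left h1', sub_ne_zero, inv_mul_eq_div]
    exact_mod_cast hne
  ext L
  rw [h.mem_quasiLines_iff hN hq hq₁ hq₂]
  simp only [gammaThird_isQuasiPair_iff hq hϱ hτ, gammaThird_isQuasiPair_zero_one_iff hq hϱ hτ, h1,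
    true_and, h1', sub_self, zero_mul, zero_eq_mul, pow_eq_zero_iff two_ne_zero, hq', hne',
    or_false, exists_eq_left, Set.mem_insert_iff, Set.mem_singleton_iff]

theorem quasiLines_gammaThird_of_ne_one {ϱ τ : ℝ} (h : IsCalculus (gammaThirdCoeffs N q ϱ τ) d)
    (hN : 2 ≤ N) (hq : q ≠ 0) (hq₁ : q ≠ 1) (hq₂ : q ≠ -1) (hϱ : ϱ ≠ 0) (hτ : τ ≠ 0)
    (h1 : sPlus' N q * ϱ ≠ 1) :
    quasiLines d = {Submodule.span ℂ {hPlus d + ((q : ℂ) ^ 2 * τ / ϱ) • hMinus d},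
      Submodule.span ℂ {hPlus d + ((q : ℂ) ^ 2 * (sPlus' N q * τ - (q : ℂ) ^ 2) /
        (sPlus' N q * ϱ - 1)) • hMinus d}} := by
  have h1' : (sPlus' N q * ϱ - 1 : ℂ) ≠ 0 := by
    rw [sub_ne_zero]
    exact_mod_cast h1
  have hdiv (l r : ℂ) : (sPlus' N q * ϱ - 1) * l = r ↔ l = r / (sPlus' N q * ϱ - 1) := by
    rw [eq_div_iff h1', mul_comm]
  ext L
  rw [h.mem_quasiLines_iff hN hq hq₁ hq₂]
  simp only [gammaThird_isQuasiPair_iff hq hϱ hτ, gammaThird_isQuasiPair_zero_one_iff hq hϱ hτ, h1,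
    false_and, or_false, hdiv, or_and_right, exists_or,
    exists_eq_left, Set.mem_insert_iff, Set.mem_singleton_iff]

/-- After cross-multiplication the `s'` terms cancel and equality of the roots becomes `τ = q²ϱ`. -/
theorem gammaThird_roots_ne {ϱ τ : ℝ} (hq : q ≠ 0) (hϱ : ϱ ≠ 0) (hne : τ / ϱ ≠ q ^ 2)
    (h1 : sPlus' N q * ϱ ≠ 1) :
    (q : ℂ) ^ 2 * τ / ϱ ≠
      (q : ℂ) ^ 2 * (sPlus' N q * τ - (q : ℂ) ^ 2) / (sPlus' N q * ϱ - 1) := by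
  have hq' : (q : ℂ) ≠ 0 := by exact_mod_cast hq
  have hϱ0 : (ϱ : ℂ) ≠ 0 := by exact_mod_cast hϱ
  have h1' : (sPlus' N q * ϱ - 1 : ℂ) ≠ 0 := by
    rw [sub_ne_zero]
    exact_mod_cast h1
  intro h0
  rw [div_eq_div_iff hϱ0 h1', mul_assoc, mul_assoc] at h0
  have h2 := mul_left_cancel₀ (pow_ne_zero 2 hq') h0
  have h3 : (τ : ℂ) = q ^ 2 * ϱ := by linear_combination -h2
  apply hne
  rw [div_eq_iff hϱ]
  exact_mod_cast h3

end Classification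

end QuantumSphere

/-! ### Assembly of the classification -/

theorem mainTheorem6 (N : ℕ) (hN : 2 ≤ N) (q : ℝ) (hq₀ : q ≠ 0) (hq₁ : q ≠ 1) (hq₂ : q ≠ -1)
    {Γ : Type*} [AddCommGroup Γ] [Module ℂ Γ]
    [Module (QuantumSphere.Sphere N q) Γ] [Module (QuantumSphere.Sphere N q)ᵐᵒᵖ Γ]
    [SMulCommClass (QuantumSphere.Sphere N q) (QuantumSphere.Sphere N q)ᵐᵒᵖ Γ]
    [IsScalarTower ℂ (QuantumSphere.Sphere N q) Γ]
    [IsScalarTower ℂ (QuantumSphere.Sphere N q)ᵐᵒᵖ Γ]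
    (d : QuantumSphere.Sphere N q →ₗ[ℂ] Γ) :
    -- the calculi `Γ_{ατ}`
    (∀ α τ : ℝ, α ≠ 0 → α ≠ (q ^ 2)⁻¹ →
      QuantumSphere.IsCalculus (QuantumSphere.gammaCoeffs N q α τ) d →
        (∀ η ∈ QuantumSphere.invariantForms d, QuantumSphere.QuasiCommutesGenerators N q η →
          QuantumSphere.QuasiCommutesHomogeneous N q η) ∧
        QuantumSphere.quasiLines d =
          {Submodule.span ℂ {QuantumSphere.hPlus d + (α : ℂ)⁻¹ • QuantumSphere.hMinus d}}) ∧
    -- the calculi `Γ'_{αω}` with real `α`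
    (∀ α ω : ℝ, α ≠ 0 → α ≠ (q ^ 2)⁻¹ → ω ≠ 0 →
      QuantumSphere.IsCalculus (QuantumSphere.gammaPrimeCoeffs q α ω) d →
        (∀ η ∈ QuantumSphere.invariantForms d, QuantumSphere.QuasiCommutesGenerators N q η →
          QuantumSphere.QuasiCommutesHomogeneous N q η) ∧
        QuantumSphere.quasiLines d =
          {Submodule.span ℂ {QuantumSphere.hPlus d + (α : ℂ)⁻¹ • QuantumSphere.hMinus d}}) ∧
    -- the calculi `Γ''_{ωψ}`
    (∀ ω ψ : ℝ, ω ≠ 0 →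
      QuantumSphere.IsCalculus (QuantumSphere.gammaSecondCoeffs q ω ψ) d →
        (∀ η ∈ QuantumSphere.invariantForms d, QuantumSphere.QuasiCommutesGenerators N q η →
          QuantumSphere.QuasiCommutesHomogeneous N q η) ∧
        QuantumSphere.quasiLines d =
          {L | ∃ l : ℂ, ((q : ℂ) ^ 4)⁻¹ * ω * l ^ 2 - ((q : ℂ) ^ 2)⁻¹ * ω * ψ * l + 1 = 0 ∧
            L = Submodule.span ℂ {QuantumSphere.hPlus d + l • QuantumSphere.hMinus d}} ∧
        (ω * ψ ^ 2 ≠ 4 → (QuantumSphere.quasiLines d).ncard = 2) ∧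
        (ω * ψ ^ 2 = 4 → (QuantumSphere.quasiLines d).ncard = 1)) ∧
    -- the calculi `Γ'''_{ϱτ}`
    (∀ ϱ τ : ℝ, ϱ ≠ 0 → τ ≠ 0 →
      QuantumSphere.IsCalculus (QuantumSphere.gammaThirdCoeffs N q ϱ τ) d →
        (∀ η ∈ QuantumSphere.invariantForms d, QuantumSphere.QuasiCommutesGenerators N q η →
          QuantumSphere.QuasiCommutesHomogeneous N q η) ∧
        (τ / ϱ ≠ q ^ 2 →
          (QuantumSphere.quasiLines d).ncard = 2 ∧
          (QuantumSphere.sPlus' N q * ϱ = 1 →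
            QuantumSphere.quasiLines d =
              {Submodule.span ℂ
                {QuantumSphere.hPlus d + ((q : ℂ) ^ 2 * τ / ϱ) • QuantumSphere.hMinus d},
               Submodule.span ℂ {QuantumSphere.hMinus d}}) ∧
          (QuantumSphere.sPlus' N q * ϱ ≠ 1 →
            QuantumSphere.quasiLines d =
              {Submodule.span ℂ
                {QuantumSphere.hPlus d + ((q : ℂ) ^ 2 * τ / ϱ) • QuantumSphere.hMinus d},
               Submodule.span ℂ
                {QuantumSphere.hPlus d +
                  ((q : ℂ) ^ 2 * (QuantumSphere.sPlus' N q * τ - (q : ℂ) ^ 2) /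
                    (QuantumSphere.sPlus' N q * ϱ - 1)) • QuantumSphere.hMinus d}})) ∧
        (ϱ = (q ^ 2)⁻¹ * τ → ϱ ≠ (QuantumSphere.sPlus' N q)⁻¹ →
          QuantumSphere.quasiLines d =
            {Submodule.span ℂ {QuantumSphere.hPlus d + (q : ℂ) ^ 4 • QuantumSphere.hMinus d}}) ∧
        (ϱ = (q ^ 2)⁻¹ * τ → ϱ = (QuantumSphere.sPlus' N q)⁻¹ →
          ∀ η ∈ QuantumSphere.invariantForms d,
            QuantumSphere.QuasiCommutesGenerators N q η)) := by
  refine ⟨?_, ?_, ?_, ?_⟩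
  · intro α τ hα hα' h
    exact ⟨h.quasiCommutesHomogeneous hN hq₀ hq₁ hq₂,
      h.quasiLines_eq_singleton hN hq₀ hq₁ hq₂ hα hα' rfl rfl
        (QuantumSphere.gamma_isQuasiPair hq₀ hα τ)⟩
  · intro α ω hα hα' hω h
    exact ⟨h.quasiCommutesHomogeneous hN hq₀ hq₁ hq₂,
      h.quasiLines_eq_singleton hN hq₀ hq₁ hq₂ hα hα' rfl rfl
        (QuantumSphere.gammaPrime_isQuasiPair hq₀ hα hω)⟩
  · intro ω ψ hω h
    exact ⟨h.quasiCommutesHomogeneous hN hq₀ hq₁ hq₂,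
      QuantumSphere.quasiLines_gammaSecond h hN hq₀ hq₁ hq₂ hω,
      QuantumSphere.ncard_quasiLines_gammaSecond h hN hq₀ hq₁ hq₂ hω⟩
  · intro ϱ τ hϱ hτ h
    refine ⟨h.quasiCommutesHomogeneous hN hq₀ hq₁ hq₂, ?_, ?_, ?_⟩
    · intro hne
      refine ⟨?_, QuantumSphere.quasiLines_gammaThird_of_eq_one h hN hq₀ hq₁ hq₂ hϱ hτ hne,
        QuantumSphere.quasiLines_gammaThird_of_ne_one h hN hq₀ hq₁ hq₂ hϱ hτ⟩
      by_cases h1 : QuantumSphere.sPlus' N q * ϱ = 1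
      · rw [QuantumSphere.quasiLines_gammaThird_of_eq_one h hN hq₀ hq₁ hq₂ hϱ hτ hne h1]
        exact Set.ncard_pair (h.isFreelyGenerated.span_hPlus_add_ne hN hq₀ hq₁ hq₂ _)
      · rw [QuantumSphere.quasiLines_gammaThird_of_ne_one h hN hq₀ hq₁ hq₂ hϱ hτ h1]
        exact Set.ncard_pair fun h0 => QuantumSphere.gammaThird_roots_ne hq₀ hϱ hne h1
          (h.isFreelyGenerated.span_hPlus_add_injective hN hq₀ hq₁ hq₂ h0)
    · intro h1 h2
      have hs : QuantumSphere.sPlus' N q * ϱ ≠ 1 := fun h0 => h2 (eq_inv_of_mul_eq_one_right h0)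
      have hq' : (q : ℂ) ≠ 0 := by exact_mod_cast hq₀
      have hϱ' : (ϱ : ℂ) ≠ 0 := by exact_mod_cast hϱ
      have hs' : (QuantumSphere.sPlus' N q * ϱ - 1 : ℂ) ≠ 0 := by
        rw [sub_ne_zero]
        exact_mod_cast hs
      have hτϱ : (τ : ℂ) = q ^ 2 * ϱ := by
        rw [h1]
        push_cast
        field_simp
      have e1 : (q : ℂ) ^ 2 * τ / ϱ = q ^ 4 := by
        rw [hτϱ]
        field_simp
      have e2 : (q : ℂ) ^ 2 * (QuantumSphere.sPlus' N q * τ - (q : ℂ) ^ 2) /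
          (QuantumSphere.sPlus' N q * ϱ - 1) = q ^ 4 := by
        rw [hτϱ, div_eq_iff hs']
        ring
      rw [QuantumSphere.quasiLines_gammaThird_of_ne_one h hN hq₀ hq₁ hq₂ hϱ hτ hs, e1, e2,
        Set.pair_eq_singleton]
    · intro h1 h2 η hη
      obtain ⟨m, l, rfl⟩ := QuantumSphere.mem_invariantForms.1 hη
      -- Since `0⁻¹ = 0`, the hypothesis `ϱ = s'⁻¹` with `ϱ ≠ 0` excludes `s' = 0`.
      have hs0 : QuantumSphere.sPlus' N q ≠ 0 := by
        intro h0
        rw [h0, inv_zero] at h2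
        exact hϱ h2
      have hs : QuantumSphere.sPlus' N q * ϱ = 1 := by rw [h2, mul_inv_cancel₀ hs0]
      exact (h.quasiCommutesGenerators_iff hN hq₀ hq₁ hq₂ m l).2
        ⟨_, _, QuantumSphere.gammaThird_isQuasiPair_of_eq hq₀ hϱ h1 hs m l⟩
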